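/- **Setting.** Let $\bigwedge=\{x<z>y\}$ be the face poset of an interval and let $k\ge 1$. Let $P$ be a *locally finite cubical poset*: for every $p\in P$ the set $P_{\le p}$ is isomorphic to some power $\bigwedge^n$, and $P_{\ge p}$ is finite. Let $\Box_P$ be the associated complex of cubes, and let $P^j$ be the set of its $j$-dimensional faces ($P_{\le p}\cong\bigwedge^j$; equivalently, $p$ covers exactly $2j$ elements). Orient the cubes arbitrarily and let $[c:b]=\pm1$ denote the cellular incidence numbers and $(\delta f)(c)=\sum_{b<c}[c:b]f(b)$ the cellular coboundary. **Link graph.** Let $\varphi$ be an extra element below all of $P^k$. The multigraph $\Gamma$ has as vertices the pairs $(p,b)$ with $b\in P^k$ and $b>p\in P^{k-1}\cup\{\varphi\}$. For every $c\in P^{k+1}$ and every pair of distinct $b,b'\in P^k$ below $c$ it has an edge $(\{b,b'\},c)$ joining $(b\bowtie b',b)$ and $(b\bowtie b',b')$, where $b\bowtie b'$ is the infimum of $b,b'$ in $P$ if that exists and lies in $P^{k-1}$, and $\varphi$ otherwise. All vertices $(p,b)$ of a connected component $a$ of $\Gamma$ have the same $p$; call $a$ *geometric* if $p\in P^{k-1}$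 and *transversal* if $p=\varphi$. Write $a<b$ if some $(p,b)$ is a vertex of $a$, and let $S_{>a}\subseteq P^k\cup P^{k+1}$ consist of the $b\in P^k$ with $a<b$ and of the $c\in P^{k+1}$ above such a $b$. The *spectral gap* of a component is that of its normalized Laplacian, i.e. the infimum of $\sum_{\text{edges }vv'}(f(v)-f(v'))^2$ over all $f$ with $\sum_v\deg(v)f(v)=0$ and $\sum_v\deg(v)f(v)^2=1$. $P$ is *transversally finite* (for $k$) if all transversal components are finite. It is *$k$-monodromy-free* if for every transversal component $a$ the poset $P(a)$ of all faces of those $c\in P^{k+1}$ that occur in the edges of $a$ is isomorphic to $S_{>a}\times\bigwedge^k$. **Cohomology.** For $j\in\{k-1,k\}$ let $C^j$ be the space of all $f:P^j\to\mathbb R$ with $\sum_x \#\{c\in P^{k+1}:c\ge x\}\,f(x)^2<\infty$ (all cochains, if $P$ is finite), and let $\widetilde{\mathrm H}^k(\Box_P)=\{f\in C^k:\delta f=0\}/\delta C^{k-1}$. This is the ordinary real cohomology if $P$ is finite. A *Garland orientation* assigns a sign $w_{ab}=\pm1$ to every pair $a<b$ (equivalently, to every vertex $(p,b)$ of $\Gamma$,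 $a$ being its component), so that $w_{ab}=[b:p]$ if $a$ is geometric and $(p,b)$ is its vertex over $b$, and so that $w_{ab}[c:b]=-w_{ab'}[c:b']$ for every edge $(\{b,b'\},c)$ of $a$. Given one, let $L_{k,P}$ (resp. $T_{k,P}$) be the subspace of the classes of the cocycles $b\mapsto\sum_{a<b}w_{ab}\,g(a)$, where $g$ runs over the real functions on the set of components that vanish off the geometric (resp. transversal) ones and satisfy $\sum_a\#\{\text{edges of }a\}\,g(a)^2<\infty$. **Theorem.** Let $P$ be a locally finite, transversally finite, $k$-monodromy-free cubical poset such that every connected component of $\Gamma$, geometric or transversal, has spectral gap greater than $\frac{2k}{2k+1}$. Then Garland orientations exist, and for each of them: 1. if $P$ is finite, then $\widetilde{\mathrm H}^k(\Box_P)=L_{k,P}+T_{k,P}$; 2. if, for $P$ possibly infinite, the infimum of the spectral gaps of all components is greater than $\frac{2k}{2k+1}$, then $\widetilde{\mathrm H}^k(\Box_P)=L_{k,P}+T_{k,P}$; 3. in every case $L_{k,P}+T_{k,P}$ is dense in $\widetilde{\mathrm H}^k(\Box_P)$: every cocycle in $C^k$ is a limit, in the weighted $\ell^2$-norm of $C^k$,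 of cocycles whose classes lie in $L_{k,P}+T_{k,P}$. Equivalently, $L_{k,P}+T_{k,P}$ has dense image in reduced cohomology (cocycles modulo the closure of the coboundaries). -/

import Mathlib

/-! ### Cubical posets -/

/-- The face poset `⋀ = {left < whole > right}` of an interval. -/
inductive Wedge : Type
  | left : Wedge
  | right : Wedge
  | whole : Wedge
  deriving DecidableEq

namespace Wedge

instance : Fintype Wedge where
  elems := {left, right, whole}
  complete x := by cases x <;> simp

instance : PartialOrder Wedge where
  le x y := x = y ∨ y = whole
  le_refl x := Or.inl rfl
  le_trans x y z := by
    rintro (rfl | rfl) (rfl | rfl) <;> simp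
  le_antisymm x y := by
    rintro (rfl | rfl) (h | rfl)
    · rfl
    · rfl
    · exact h.symm
    · rfl

/-- The midpoint of a face of the interval `[-1, 1]`. -/
def mid : Wedge → ℤ
  | left => -1
  | right => 1
  | whole => 0

end Wedge

namespace CubicalGarland

/-- `⋀ⁿ`, the face poset of the `n`-cube `[-1, 1]ⁿ`. -/
abbrev Cube (n : ℕ) : Type := Fin n → Wedge

/-- A cubical poset: every principal lower set is a finite power of `⋀`. -/
def IsCubical (P : Type*) [PartialOrder P] : Prop :=
  ∀ p : P, ∃ n : ℕ, Nonempty (Set.Iic p ≃o Cube n)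

/-- Local finiteness: every `P_{≥ p}` is finite. -/
def IsLocallyFinite (P : Type*) [PartialOrder P] : Prop :=
  ∀ p : P, (Set.Ici p).Finite

/-- `P^j`, the `j`-dimensional faces: those `p` with `P_{≤ p} ≅ ⋀ʲ` (in a cubical poset these are
the elements that cover exactly `2 j` elements). -/
def Face (P : Type*) [PartialOrder P] (j : ℕ) : Type _ :=
  {p : P // Nonempty (Set.Iic p ≃o Cube j)}

/-- A choice, for every face, of an identification of its face poset with that of a standard cube;
it orients every cell of the cubical complex `□_P`. -/
def Charts (P : Type*) [PartialOrder P] : Type _ :=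
  ∀ (j : ℕ) (p : Face P j), Set.Iic p.1 ≃o Cube j

section

variable {P : Type*} [PartialOrder P]

theorem Face.finite_Iic {j : ℕ} (c : Face P j) : (Set.Iic c.1).Finite := by
  obtain ⟨e⟩ := c.2
  have : Finite (Set.Iic c.1) := Finite.of_equiv _ e.symm.toEquiv
  exact Set.toFinite _

theorem Face.ne_of_ne {i j : ℕ} (hij : i ≠ j) (p : Face P i) (b : Face P j) : p.1 ≠ b.1 := by
  intro h
  obtain ⟨e⟩ := p.2
  obtain ⟨e'⟩ := b.2
  rw [h] at e
  have h1 := Fintype.card_congr (e.symm.trans e').toEquiv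
  have h2 : Fintype.card Wedge = 3 := rfl
  simp only [Cube, Fintype.card_pi, h2, Finset.prod_const, Finset.card_univ, Fintype.card_fin] at h1
  exact hij (Nat.pow_right_injective (le_refl 2 |>.trans (by norm_num)) h1)

theorem Face.finite_below {i j : ℕ} (c : Face P j) : {b : Face P i | b.1 < c.1}.Finite :=
  Set.Finite.of_finite_image
    (c.finite_Iic.subset (by rintro _ ⟨b, hb, rfl⟩; exact le_of_lt hb))
    (Subtype.val_injective.injOn)

/-! ### The cellular cochain complex -/

/-- The midpoint, in `[-1, 1]ⁿ`, of a face of the standard cube. -/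
def midpoint {n : ℕ} (x : Cube n) : Fin n → ℤ := fun i => (x i).mid

/-- The facet `x_i = 1` of the standard cube. -/
def posFacet {n : ℕ} (i : Fin n) : Cube n := Function.update (fun _ => Wedge.whole) i Wedge.right

/-- The cellular incidence number `[c : b]` of a `j`-face `b` in a `(j+1)`-face `c` (zero if `b` is
not a face of `c`): in the coordinates of `c`, the determinant of the frame that consists of the
outward normal of `b` followed by the coordinate directions of `b`. -/
noncomputable def incidence (χ : Charts P) {j : ℕ} (b : Face P j) (c : Face P (j + 1)) : ℤ :=
  open Classical in
  if h : b.1 < c.1 then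
    let center : Fin (j + 1) → ℤ := midpoint (χ (j + 1) c ⟨b.1, le_of_lt h⟩)
    let direction : Fin j → Fin (j + 1) → ℤ := fun i =>
      midpoint (χ (j + 1) c ⟨((χ j b).symm (posFacet i)).1,
        le_trans ((χ j b).symm (posFacet i)).2 (le_of_lt h)⟩) - center
    Matrix.det (Matrix.of (Fin.cons center direction : Fin (j + 1) → Fin (j + 1) → ℤ))
  else 0

/-- The cellular coboundary `(δ f)(c) = ∑_{b < c} [c : b] f(b)` on real cochains of `□_P`. -/
noncomputable def coboundary (χ : Charts P) (j : ℕ) :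
    (Face P j → ℝ) →ₗ[ℝ] (Face P (j + 1) → ℝ) where
  toFun f c := ∑ b ∈ (Face.finite_below (i := j) c).toFinset, (incidence χ b c : ℝ) * f b
  map_add' f g := by
    funext c
    simp [mul_add, Finset.sum_add_distrib]
  map_smul' r f := by
    funext c
    simp [Finset.mul_sum, mul_left_comm]

end

/-- The square-summable functions for the weights `ω`. -/
def weightedL2 {ι : Type*} (ω : ι → ℕ) : Submodule ℝ (ι → ℝ) where
  carrier := {f | Summable fun i => (ω i : ℝ) * f i ^ 2}
  zero_mem' := by simp [summable_zero]
  add_mem' := by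
    intro f g hf hg
    refine Summable.of_nonneg_of_le (fun i => by positivity) (fun i => ?_)
      ((hf.mul_left 2).add (hg.mul_left 2))
    have h : (0 : ℝ) ≤ ω i := Nat.cast_nonneg _
    have h' := mul_nonneg h (sq_nonneg (f i - g i))
    simp only [Pi.add_apply]
    nlinarith
  smul_mem' := by
    intro r f hf
    have h : (fun i => (ω i : ℝ) * (r • f) i ^ 2) = fun i => r ^ 2 * ((ω i : ℝ) * f i ^ 2) := by
      funext i
      simp only [Pi.smul_apply, smul_eq_mul]
      ring
    change Summable _
    rw [h]
    exact Summable.mul_left _ hf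

/-- On a finite index set square-summability is no restriction. -/
theorem weightedL2_eq_top {ι : Type*} [Finite ι] (ω : ι → ℕ) : weightedL2 ω = ⊤ :=
  eq_top_iff.mpr fun _ _ => Summable.of_finite

/-! ### The link graph

Throughout, `m` stands for `k - 1`, so that `m`, `m + 1`, `m + 2` are the dimensions `k - 1`, `k`,
`k + 1`. -/

section

variable {P : Type*} [PartialOrder P] {m : ℕ}

/-- The vertices `(p, b)` of `Γ`, where `b ∈ P^k` and `p < b` is in `P^{k-1} ∪ {φ}`; the additional
element `φ` is `none`. -/
structure LinkVertex (P : Type*) [PartialOrder P] (m : ℕ) where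
  base : Option (Face P m)
  face : Face P (m + 1)
  lt : ∀ p : Face P m, base = some p → p.1 < face.1

/-- `b ⋈ b'`: the infimum of `b` and `b'` in `P` if it exists and lies in `P^{k-1}`, else `φ`. -/
noncomputable def bowtie (b b' : Face P (m + 1)) : Option (Face P m) :=
  open Classical in
  if h : ∃ p : Face P m, IsGLB {b.1, b'.1} p.1 then some h.choose else none

theorem bowtie_comm (b b' : Face P (m + 1)) : bowtie b b' = bowtie b' b := by
  unfold bowtie
  rw [Set.pair_comm]

theorem lt_of_bowtie {b b' : Face P (m + 1)} (p : Face P m) (hp : bowtie b b' = some p) :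
    p.1 < b.1 := by
  unfold bowtie at hp
  split_ifs at hp with h
  cases hp
  exact lt_of_le_of_ne (h.choose_spec.1 (by simp)) (Face.ne_of_ne (by omega) _ _)

/-- The edges `({b, b'}, c)` of `Γ`, each taken with both of its orientations `(b, b')` and
`(b', b)`. -/
structure Dart (P : Type*) [PartialOrder P] (m : ℕ) where
  fst : Face P (m + 1)
  snd : Face P (m + 1)
  top : Face P (m + 2)
  fst_lt : fst.1 < top.1
  snd_lt : snd.1 < top.1
  ne : fst ≠ snd

/-- The dart `(b, b', c)` starts at `(b ⋈ b', b)`. -/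
noncomputable def Dart.src (d : Dart P m) : LinkVertex P m :=
  ⟨bowtie d.fst d.snd, d.fst, lt_of_bowtie⟩

/-- The dart `(b, b', c)` ends at `(b ⋈ b', b')`. -/
noncomputable def Dart.tgt (d : Dart P m) : LinkVertex P m :=
  ⟨bowtie d.fst d.snd, d.snd, fun p hp => lt_of_bowtie p ((bowtie_comm _ _).trans hp)⟩

/-- The simple graph that underlies the (multi)graph `Γ`. -/
def linkGraph (P : Type*) [PartialOrder P] (m : ℕ) : SimpleGraph (LinkVertex P m) where
  Adj v v' := ∃ d : Dart P m, d.src = v ∧ d.tgt = v'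
  symm := ⟨by
    rintro _ _ ⟨d, rfl, rfl⟩
    refine ⟨⟨d.snd, d.fst, d.top, d.snd_lt, d.fst_lt, d.ne.symm⟩, ?_, ?_⟩ <;>
      simp [Dart.src, Dart.tgt, bowtie_comm d.snd d.fst]⟩
  loopless := ⟨by
    rintro _ ⟨d, rfl, h⟩
    exact d.ne (congrArg LinkVertex.face h).symm⟩

/-- `S^{-1}`: the connected components of `Γ`. -/
abbrev Component (P : Type*) [PartialOrder P] (m : ℕ) : Type _ :=
  (linkGraph P m).ConnectedComponent

/-- The component of a vertex of `Γ`. -/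
abbrev LinkVertex.component (v : LinkVertex P m) : Component P m :=
  (linkGraph P m).connectedComponentMk v

/-- `π` on `S^{-1}`: all vertices `(p, b)` of a component have the same `p ∈ P^{k-1} ∪ {φ}`. -/
def Component.proj (a : Component P m) : Option (Face P m) :=
  SimpleGraph.ConnectedComponent.lift LinkVertex.base (by
    intro v v' q hq
    clear hq
    induction q with
    | nil => rfl
    | cons h q ih =>
      obtain ⟨d, rfl, rfl⟩ := h
      exact Eq.trans rfl ih) a

/-- Transversal components are those over `φ`. -/
def Component.IsTransversal (a : Component P m) : Prop := a.proj = none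

/-- Geometric components are those over a face in `P^{k-1}`. -/
def Component.IsGeometric (a : Component P m) : Prop := ∃ p : Face P m, a.proj = some p

/-- The oriented edges of a component. -/
def Component.darts (a : Component P m) : Set (Dart P m) := {d | d.src.component = a}

/-- The order relation `a < b` of the Garland poset, for `a ∈ S^{-1}` and `b ∈ S^0 = P^k`. -/
def Component.Below (a : Component P m) (b : Face P (m + 1)) : Prop :=
  ∃ v : LinkVertex P m, v.component = a ∧ v.face = b

/-- `S_{>a}`, with the order induced from `P`. -/
def Component.above (a : Component P m) : Set P :=
  {x | (∃ b : Face P (m + 1), a.Below b ∧ x = b.1) ∨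
    ∃ (b : Face P (m + 1)) (c : Face P (m + 2)), a.Below b ∧ b.1 < c.1 ∧ x = c.1}

/-- `P(a)`: the faces of the `(k+1)`-cubes that occur in the edges of the component `a`. -/
def Component.carrier (a : Component P m) : Set P := {p | ∃ d ∈ a.darts, p ≤ d.top.1}

/-- All transversal components are finite. -/
def IsTransversallyFinite (P : Type*) [PartialOrder P] (m : ℕ) : Prop :=
  ∀ a : Component P m, a.IsTransversal → a.supp.Finite

/-- `k`-monodromy-freeness (`k = m + 1`): `P(a) ≅ S_{>a} × ⋀ᵏ` for every transversal `a`. -/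
def IsMonodromyFree (P : Type*) [PartialOrder P] (m : ℕ) : Prop :=
  ∀ a : Component P m, a.IsTransversal → Nonempty (a.carrier ≃o a.above × Cube (m + 1))

/-! ### Spectral gaps -/

/-- The degree of a vertex of `Γ`: the number of edges at it. -/
noncomputable def LinkVertex.degree (v : LinkVertex P m) : ℕ := {d : Dart P m | d.src = v}.ncard

/-- The Dirichlet form of a component, `∑_{edges} (f(v) - f(v'))²`. -/
noncomputable def Component.energy (a : Component P m) (f : LinkVertex P m → ℝ) : ℝ :=
  (∑ᶠ d ∈ a.darts, (f d.src - f d.tgt) ^ 2) / 2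

/-- The spectral gap of the normalized Laplacian of a component: the infimum of the Dirichlet form
over the functions orthogonal to the constants and of norm one in `ℓ²(degree)` (`⊤` if there are
none). -/
noncomputable def Component.spectralGap (a : Component P m) : EReal :=
  ⨅ (f : LinkVertex P m → ℝ) (_ : ∑ᶠ v ∈ a.supp, (v.degree : ℝ) * f v = 0)
    (_ : ∑ᶠ v ∈ a.supp, (v.degree : ℝ) * f v ^ 2 = 1), (a.energy f : EReal)

/-! ### The Garland complex and the subspaces `L` and `T` of the cohomology -/

/-- An orientation of the Garland poset that extends the cellular one. The cover relations `a < b`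
with `a ∈ S^{-1}` and `b ∈ S^0` correspond to the vertices of `Γ`. -/
structure IsGarlandOrientation (χ : Charts P) (w : LinkVertex P m → ℤ) : Prop where
  sign : ∀ v, w v = 1 ∨ w v = -1
  cellular : ∀ (v : LinkVertex P m) (p : Face P m), v.base = some p → w v = incidence χ p v.face
  cancel : ∀ d : Dart P m,
    w d.src * incidence χ d.fst d.top = -(w d.tgt * incidence χ d.snd d.top)

/-- The number of `(k+1)`-faces that contain a face. -/
noncomputable def topDegree (m : ℕ) {j : ℕ} (x : Face P j) : ℕ :=
  {c : Face P (m + 2) | x.1 ≤ c.1}.ncard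

/-- Square-summable cochains of degree `j ∈ {k - 1, k, k + 1}`, for the norm that they have in the
Garland complex; all cochains if `P` is finite. -/
noncomputable def l2Cochains (P : Type*) [PartialOrder P] (m j : ℕ) : Submodule ℝ (Face P j → ℝ) :=
  weightedL2 (topDegree m)

theorem l2Cochains_eq_top [Finite P] (j : ℕ) : l2Cochains P m j = ⊤ :=
  have : Finite (Face P j) := Subtype.finite
  weightedL2_eq_top _

/-- The square-summable functions on `S^{-1}`; the weight is twice the number of edges. -/
noncomputable def l2Components (P : Type*) [PartialOrder P] (m : ℕ) :
    Submodule ℝ (Component P m → ℝ) :=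
  weightedL2 fun a => a.darts.ncard

/-- The first differential of the Garland complex, up to a nonzero constant factor:
`b ↦ ∑_{a < b} w_{ab} g(a)`. -/
noncomputable def garlandCoboundary (w : LinkVertex P m → ℤ) (g : Component P m → ℝ) :
    Face P (m + 1) → ℝ :=
  fun b => ∑ᶠ (v : LinkVertex P m) (_ : v.face = b), (w v : ℝ) * g v.component

/-- Square-summable `k`-cocycles. -/
noncomputable def cocycles (χ : Charts P) (m : ℕ) : Submodule ℝ (Face P (m + 1) → ℝ) :=
  l2Cochains P m (m + 1) ⊓ LinearMap.ker (coboundary χ (m + 1))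

/-- Coboundaries of square-summable `(k-1)`-cochains. -/
noncomputable def coboundaries (χ : Charts P) (m : ℕ) : Submodule ℝ (Face P (m + 1) → ℝ) :=
  (l2Cochains P m m).map (coboundary χ m)

/-- The cohomology `H^k(□_P)` of square-summable real cochains, `k = m + 1`; it is the ordinary
cellular cohomology if `P` is finite. -/
abbrev Cohomology (χ : Charts P) (m : ℕ) : Type _ :=
  cocycles χ m ⧸ (coboundaries χ m).submoduleOf (cocycles χ m)

/-- The class of a cocycle. -/
noncomputable abbrev cohomologyClass (χ : Charts P) (m : ℕ) :
    cocycles χ m →ₗ[ℝ] Cohomology χ m :=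
  ((coboundaries χ m).submoduleOf (cocycles χ m)).mkQ

/-- The image, under the connecting homomorphism `g ↦ [garlandCoboundary w g]`, of the
square-summable functions on the set `A` of components of the link graph. -/
noncomputable def connectingImage (χ : Charts P) (w : LinkVertex P m → ℤ)
    (A : Set (Component P m)) : Submodule ℝ (Cohomology χ m) :=
  Submodule.span ℝ {ξ | ∃ g ∈ l2Components P m, (∀ a, a ∉ A → g a = 0) ∧
    ∃ z : cocycles χ m, z.1 = garlandCoboundary w g ∧ ξ = cohomologyClass χ m z}

/-- `L_{k,P}`: the classes that come from geometric components. -/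
noncomputable def geometricClasses (χ : Charts P) (w : LinkVertex P m → ℤ) :
    Submodule ℝ (Cohomology χ m) :=
  connectingImage χ w {a | a.IsGeometric}

/-- `T_{k,P}`: the classes that come from transversal components. -/
noncomputable def transversalClasses (χ : Charts P) (w : LinkVertex P m → ℤ) :
    Submodule ℝ (Cohomology χ m) :=
  connectingImage χ w {a | a.IsTransversal}

/-- A subspace of the cohomology is dense if its preimage is dense in the space of square-summable
cocycles; equivalently, its image in reduced cohomology (cocycles modulo the closure of the
coboundaries) is dense. -/
def IsDense (χ : Charts P) (U : Submodule ℝ (Cohomology χ m)) : Prop :=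
  ∀ f : cocycles χ m, ∀ ε : ℝ, 0 < ε → ∃ z : cocycles χ m, cohomologyClass χ m z ∈ U ∧
    ∑' b, (topDegree m b : ℝ) * (f.1 b - z.1 b) ^ 2 < ε

end

end CubicalGarland

/-! Write D for the map taking a function g on the components of Γ to b ↦ ∑_{a<b} w_{ab} g(a). Each
value (D g)(b) is a sum over the vertices (p, b) of Γ, and there are exactly 2k + 1 of them: 2k
facets of b and φ. Summed against [c:b] over the facets of a (k+1)-cube c, the terms correspond to
the oriented edges of Γ in c; reversing an edge pairs them off, and the Garland sign rule makes each
pair cancel. So D maps into cocycles (`coboundary_garlandCoboundary`). What must be proved is that D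
maps onto the cocycles, or onto a dense subspace. No coboundaries need to be added: splitting g into
its geometric and transversal parts then gives L + T.

In the weighted ℓ²-norms D is bounded, and its adjoint M sends f to the degree-weighted means of
φ(v) = w(v) f(b), v = (p, b), over the components. Restricted to the closed space of cocycles, M
decides everything: D is onto if M is bounded below, and has dense range if M is injective
(`weighted_range`).

The lower bound is Garland's argument. The degree of (p, b) is the number n(b) of (k+1)-cubes above
b, whatever p is (`LinkVertex.degree_eq`). With ‖f‖² = ∑ n(b) f(b)², the norms of φ over all
components therefore add up to (2k+1)‖f‖². By the sign rule, the difference of φ across an edge in c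
is, up to sign, [c:b]f(b) + [c:b']f(b'). For a cocycle the 2(k+1) numbers [c:b]f(b) sum to zero,
which makes the energy inside c equal to 2k times their square sum; in total the energy is 2k‖f‖²
(`hasSum_energy`). If every gap is at least l, the Poincaré inequality on each component gives
l((2k+1)‖f‖² − ‖Mf‖²) ≤ 2k‖f‖². This bounds M below exactly when l > 2k/(2k+1)
(`componentMean_bounded_below`). With strict but not uniform gaps the same comparison still gives
injectivity (`eq_zero_of_componentMean_eq_zero`).

Garland signs exist because on geometric components they are incidence numbers and the sign rule is
δδ = 0, while on a transversal component, whose edges join opposite facets of cubes, the product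
structure S_{>a} × ⋀ᵏ supplies a frame that agrees on opposite facets (`transversalSign_cancel`). -/

namespace Wedge

/-! ### The interval: endpoints and their signs -/

instance : OrderTop Wedge where
  top := whole
  le_top _ := Or.inr rfl

theorem top_eq_whole : (⊤ : Wedge) = whole := rfl

theorem le_iff {x y : Wedge} : x ≤ y ↔ x = y ∨ y = ⊤ := Iff.rfl

@[simp] theorem mid_top : mid ⊤ = 0 := rfl

theorem mid_eq_zero {x : Wedge} : x.mid = 0 ↔ x = ⊤ := by
  cases x <;> simp [mid, top_eq_whole]

/-- The endpoints of the interval. -/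
def endpoint (v : Bool) : Wedge := if v then right else left

theorem endpoint_ne_top (v : Bool) : endpoint v ≠ ⊤ := by
  cases v <;> simp [endpoint, top_eq_whole]

theorem endpoint_injective : Function.Injective endpoint := by
  intro v v'
  cases v <;> cases v' <;> simp [endpoint]

theorem exists_endpoint {x : Wedge} (h : x ≠ ⊤) : ∃ v, x = endpoint v := by
  cases x
  · exact ⟨false, rfl⟩
  · exact ⟨true, rfl⟩
  · exact absurd rfl h

/-- The sign of an endpoint. -/
def sgn (v : Bool) : ℤ := if v then 1 else -1

theorem mid_endpoint (v : Bool) : (endpoint v).mid = sgn v := by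
  cases v <;> rfl

theorem sgn_eq (v : Bool) : sgn v = 1 ∨ sgn v = -1 := by
  cases v <;> simp [sgn]

theorem sgn_not (v : Bool) : sgn (!v) = -sgn v := by
  cases v <;> simp [sgn]

end Wedge

namespace CubicalGarland

open Wedge

/-! ### Faces of the standard cube -/

@[simp] theorem midpoint_top {n : ℕ} : midpoint (⊤ : Cube n) = 0 := rfl

/-- The facets of the standard cube. -/
def facet {n : ℕ} (t : Fin n) (v : Bool) : Cube n := Function.update ⊤ t (endpoint v)

theorem facet_true {n : ℕ} (t : Fin n) : facet t true = posFacet t := rfl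

@[simp] theorem facet_self {n : ℕ} (t : Fin n) (v : Bool) : facet t v t = endpoint v := by
  simp [facet]

theorem facet_of_ne {n : ℕ} {t t' : Fin n} (h : t' ≠ t) (v : Bool) : facet t v t' = ⊤ := by
  simp [facet, h]

theorem midpoint_facet {n : ℕ} (t : Fin n) (v : Bool) :
    midpoint (facet t v) = Pi.single t (sgn v) := by
  funext t'
  by_cases h : t' = t
  · subst h
    simp [midpoint, mid_endpoint]
  · simp [midpoint, facet_of_ne h, h]

theorem le_update_iff {n : ℕ} {x y : Cube n} (hxy : x ≤ y) (t : Fin n) (v : Bool) :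
    x ≤ Function.update y t (endpoint v) ↔ x t = endpoint v := by
  constructor
  · intro h
    have h' := h t
    rw [Function.update_self, le_iff] at h'
    exact h'.resolve_right (endpoint_ne_top v)
  · intro h t'
    by_cases ht : t' = t
    · subst ht
      simp [h]
    · simpa [ht] using hxy t'

theorem update_le {n : ℕ} {y : Cube n} {t : Fin n} (h : y t = ⊤) (u : Wedge) :
    Function.update y t u ≤ y := by
  intro t'
  by_cases ht : t' = t
  · subst ht
    simp [h]
  · simp [ht]

theorem le_facet_iff {n : ℕ} {x : Cube n} {t : Fin n} {v : Bool} :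
    x ≤ facet t v ↔ x t = endpoint v :=
  le_update_iff le_top t v

theorem facet_lt_top {n : ℕ} (t : Fin n) (v : Bool) : facet t v < ⊤ := by
  refine lt_top_iff_ne_top.mpr fun h => ?_
  have := congrFun h t
  rw [facet_self] at this
  exact endpoint_ne_top v this

theorem facet_injective {n : ℕ} {t t' : Fin n} {v v' : Bool} (h : facet t v = facet t' v') :
    t = t' ∧ v = v' := by
  have h1 := le_facet_iff.mp h.le
  by_cases ht : t' = t
  · subst ht
    rw [facet_self] at h1
    exact ⟨rfl, endpoint_injective h1⟩
  · rw [facet_of_ne ht] at h1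
    exact absurd h1.symm (endpoint_ne_top _)

/-- Facets are coatoms. -/
theorem eq_facet_of_facet_le {n : ℕ} {x : Cube n} {t : Fin n} {v : Bool} (h : facet t v ≤ x)
    (hx : x ≠ ⊤) : x = facet t v := by
  refine le_antisymm (le_facet_iff.mpr ?_) h
  by_contra hne
  refine hx (funext fun t' => ?_)
  by_cases ht : t' = t
  · subst ht
    have := h t'
    rw [facet_self, le_iff] at this
    exact this.resolve_left fun h => hne h.symm
  · have := h t'
    rw [facet_of_ne ht] at this
    exact top_le_iff.mp this

/-- The meet of a facet with a face that it does not contain. -/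
theorem midpoint_of_isGLB {n : ℕ} {x z : Cube n} {t : Fin n} {v : Bool}
    (hz : IsGLB {facet t v, x} z) (hx : ¬ x ≤ facet t v) :
    midpoint z = midpoint (facet t v) + midpoint x := by
  have hzt : z t = endpoint v := le_facet_iff.mp (hz.1 (by simp))
  have hzx : z ≤ x := hz.1 (by simp)
  have hxt : x t = ⊤ := by
    have := hzx t
    rw [hzt, le_iff] at this
    exact this.resolve_left fun h => hx (le_facet_iff.mpr h.symm)
  have hz' : z = Function.update x t (endpoint v) := by
    refine le_antisymm ((le_update_iff hzx t v).mpr hzt) (hz.2 ?_)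
    rintro y (rfl | rfl)
    · exact le_facet_iff.mpr (by simp)
    · exact update_le hxt _
  rw [hz', midpoint_facet]
  funext t'
  by_cases ht : t' = t
  · subst ht
    simp [midpoint, hxt, mid_endpoint]
  · simp [midpoint, ht]

/-- The meet of two facets in different directions. -/
theorem isGLB_facets {n : ℕ} {t t' : Fin n} (h : t ≠ t') (v v' : Bool) :
    IsGLB {facet t v, facet t' v'} (Function.update (facet t v) t' (endpoint v')) := by
  refine ⟨?_, fun y hy => ?_⟩
  · rintro y (rfl | rfl)
    · exact update_le (facet_of_ne h.symm v) _
    · exact le_facet_iff.mpr (by simp)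
  · exact (le_update_iff (hy (by simp)) _ _).mpr (le_facet_iff.mp (hy (by simp)))

theorem exists_le_facet {n : ℕ} {x : Cube n} (h : x ≠ ⊤) : ∃ t v, x ≤ facet t v := by
  by_contra! hx
  refine h (funext fun t => ?_)
  by_contra ht
  obtain ⟨v, hv⟩ := exists_endpoint ht
  exact hx t v (le_facet_iff.mpr hv)

/-- An isomorphism of a cube with a face of a cube is a signed coordinate embedding. -/
theorem exists_coordinates {j n : ℕ} (ι : Cube j ↪o Cube n)
    (hι : ∀ z ≤ ι ⊤, ∃ x, ι x = z) :
    ∃ (s : Fin j → Fin n) (ε : Fin j → ℤ), Function.Injective s ∧ (∀ i, ε i = 1 ∨ ε i = -1) ∧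
      (∀ x i, midpoint (ι x) (s i) = ε i * midpoint x i) ∧
      (∀ t, ι ⊤ t = ⊤ ↔ ∃ i, s i = t) ∧
      ∀ x t, (∀ i, s i ≠ t) → ι x t = ι ⊤ t := by
  have hle : ∀ x, ι x ≤ ι ⊤ := fun x => ι.monotone le_top
  -- The image of a facet is a maximal proper face of `ι ⊤`, so it arises by fixing a single free
  -- coordinate at an endpoint.
  have hf : ∀ i v, ∃ (t : Fin n) (u : Bool), ι ⊤ t = ⊤ ∧
      ι (facet i v) = Function.update (ι ⊤) t (endpoint u) := by
    intro i v
    have hne : ι (facet i v) ≠ ι ⊤ := fun h => (facet_lt_top i v).ne (ι.injective h)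
    obtain ⟨t, ht⟩ : ∃ t, ι (facet i v) t ≠ ι ⊤ t := by
      by_contra! h
      exact hne (funext h)
    have h1 : ι ⊤ t = ⊤ := (le_iff.mp (hle (facet i v) t)).resolve_left ht
    rw [h1] at ht
    obtain ⟨u, hu⟩ := exists_endpoint ht
    refine ⟨t, u, h1, ?_⟩
    obtain ⟨x, hx⟩ := hι (Function.update (ι ⊤) t (endpoint u)) (update_le h1 _)
    rw [← hx, eq_facet_of_facet_le (x := x)]
    · rw [← ι.le_iff_le, hx]
      exact (le_update_iff (hle _) t u).mpr hu
    · rintro rfl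
      have := congrFun hx t
      rw [h1, Function.update_self] at this
      exact endpoint_ne_top u this.symm
  choose τ u hτ hu using hf
  have key : ∀ x i v, ι x (τ i v) = endpoint (u i v) ↔ x i = endpoint v := by
    intro x i v
    rw [← le_facet_iff (x := x), ← ι.le_iff_le, hu, le_update_iff (hle x)]
  have hneg : ∀ i, τ i false = τ i true ∧ u i false = !u i true := by
    intro i
    -- Opposite facets are disjoint, whereas faces obtained by fixing two different coordinates
    -- always meet.
    have h1 : τ i false = τ i true := by
      by_contra hne
      obtain ⟨x, hx⟩ := hι (Function.update (ι (facet i true)) (τ i false)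
        (endpoint (u i false))) ((update_le (by
          rw [hu, Function.update_of_ne hne, hτ]) _).trans (hle _))
      have ha : x i = endpoint false := by
        rw [← key, hx, Function.update_self]
      have hb : x i = endpoint true := by
        rw [← key, hx, Function.update_of_ne (Ne.symm hne), hu, Function.update_self]
      exact Bool.false_ne_true (endpoint_injective (ha.symm.trans hb))
    refine ⟨h1, ?_⟩
    by_contra hne
    have h2 : u i false = u i true := by
      revert hne
      cases u i false <;> cases u i true <;> simp
    have h3 : ι (facet i false) = ι (facet i true) := by rw [hu, hu, h1, h2]
    exact Bool.false_ne_true (facet_injective (ι.injective h3)).2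
  have hmid : ∀ x i, midpoint (ι x) (τ i true) = sgn (u i true) * midpoint x i := by
    intro x i
    have hr := key x i true
    have hl := key x i false
    rw [(hneg i).1, (hneg i).2] at hl
    by_cases hx : x i = ⊤
    · have : ι x (τ i true) = ⊤ := by
        by_contra hne
        obtain ⟨v, hv⟩ := exists_endpoint hne
        rw [hv, hx] at hr hl
        by_cases hvu : v = u i true
        · exact endpoint_ne_top _ (hr.mp (by rw [hvu])).symm
        · have : v = !u i true := by
            revert hvu
            cases v <;> cases u i true <;> simp
          exact endpoint_ne_top _ (hl.mp (by rw [this])).symm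
      simp [midpoint, this, hx]
    · obtain ⟨v, hv⟩ := exists_endpoint hx
      cases v
      · simp only [midpoint, hl.mpr hv, hv, mid_endpoint, sgn_not]
        simp [sgn]
      · simp only [midpoint, hr.mpr hv, hv, mid_endpoint]
        simp [sgn]
  have hrange : ∀ t, ι ⊤ t = ⊤ ↔ ∃ i, τ i true = t := by
    intro t
    constructor
    · intro ht
      by_contra! hne
      obtain ⟨x, hx⟩ := hι (Function.update (ι ⊤) t (endpoint true)) (update_le ht _)
      -- If a free coordinate `t` were missed, the preimage of the face with `t` fixed would have
      -- all its coordinates free.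
      have hxt : x = ⊤ := by
        funext i
        have h1 := hmid x i
        rw [hx, midpoint, Function.update_of_ne (hne i), hτ, mid_top] at h1
        have h2 : midpoint x i = 0 := by
          rcases sgn_eq (u i true) with h | h <;> rw [h] at h1 <;> linarith
        exact mid_eq_zero.mp h2
      rw [hxt] at hx
      have := congrFun hx t
      rw [ht, Function.update_self] at this
      exact endpoint_ne_top _ this.symm
    · rintro ⟨i, rfl⟩
      exact hτ i true
  refine ⟨fun i => τ i true, fun i => sgn (u i true), ?_, fun i => sgn_eq _, hmid, hrange, ?_⟩
  · intro i i' h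
    by_contra hne
    have h1 := hmid (facet i true) i
    have h2 := hmid (facet i true) i'
    dsimp only at h
    rw [← h, h1, midpoint_facet, Pi.single_eq_same, Pi.single_eq_of_ne (Ne.symm hne)] at h2
    rcases sgn_eq (u i true) with h | h <;> rw [h] at h2 <;> simp [sgn] at h2
  · intro x t ht
    refine (le_iff.mp (hle x t)).resolve_right fun h => ?_
    obtain ⟨i, hi⟩ := (hrange t).mp h
    exact ht i hi

/-! ### Coordinates of a face in the chart of a larger face -/

section

variable {P : Type*} [PartialOrder P]

/-- The inclusion of a face, in coordinates. -/
def chartInclusion {p q : P} (h : p ≤ q) {j n : ℕ} (e : Set.Iic p ≃o Cube j)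
    (e' : Set.Iic q ≃o Cube n) : Cube j ↪o Cube n :=
  OrderEmbedding.ofMapLEIff (fun x => e' ⟨(e.symm x).1, (e.symm x).2.trans h⟩) fun x y => by
    rw [e'.le_iff_le, ← e.symm.le_iff_le]
    rfl

theorem chartInclusion_apply {p q : P} (h : p ≤ q) {j n : ℕ} (e : Set.Iic p ≃o Cube j)
    (e' : Set.Iic q ≃o Cube n) (x : Set.Iic p) :
    chartInclusion h e e' (e x) = e' ⟨x.1, x.2.trans h⟩ := by
  simp [chartInclusion]

theorem chartInclusion_top {p q : P} (h : p ≤ q) {j n : ℕ} (e : Set.Iic p ≃o Cube j)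
    (e' : Set.Iic q ≃o Cube n) : chartInclusion h e e' ⊤ = e' ⟨p, h⟩ := by
  rw [← map_top e, chartInclusion_apply]
  rfl

theorem chartInclusion_surj {p q : P} (h : p ≤ q) {j n : ℕ} (e : Set.Iic p ≃o Cube j)
    (e' : Set.Iic q ≃o Cube n) (z : Cube n) (hz : z ≤ chartInclusion h e e' ⊤) :
    ∃ x, chartInclusion h e e' x = z := by
  rw [chartInclusion_top, ← e'.apply_symm_apply z, e'.le_iff_le] at hz
  refine ⟨e ⟨(e'.symm z).1, hz⟩, ?_⟩
  rw [chartInclusion_apply]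
  exact e'.apply_symm_apply z

/-- The directions of the coordinates of a face, in the coordinates of a larger face. -/
def directions {p q : P} (h : p ≤ q) {j n : ℕ} (e : Set.Iic p ≃o Cube j)
    (e₁ : Set.Iic q ≃o Cube n) : Matrix (Fin j) (Fin n) ℤ :=
  Matrix.of fun i => midpoint (e₁ ⟨(e.symm (posFacet i)).1, (e.symm (posFacet i)).2.trans h⟩) -
    midpoint (e₁ ⟨p, h⟩)

/-- The directions of a face are distinct coordinate directions up to sign. -/
theorem exists_directions {p q : P} (h : p ≤ q) {j n : ℕ} (e : Set.Iic p ≃o Cube j)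
    (e' : Set.Iic q ≃o Cube n) :
    ∃ (s : Fin j → Fin n) (ε : Fin j → ℤ), Function.Injective s ∧ (∀ i, ε i = 1 ∨ ε i = -1) ∧
      (∀ i, directions h e e' i = Pi.single (s i) (ε i)) ∧
      (∀ t, e' ⟨p, h⟩ t = ⊤ ↔ ∃ i, s i = t) ∧
      (∀ (x : Set.Iic p) i, midpoint (e' ⟨x.1, x.2.trans h⟩) (s i) = ε i * midpoint (e x) i) ∧
      ∀ (x : Set.Iic p) t, (∀ i, s i ≠ t) → e' ⟨x.1, x.2.trans h⟩ t = e' ⟨p, h⟩ t := by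
  obtain ⟨s, ε, hs, hε, hmid, hrange, hoff⟩ :=
    exists_coordinates (chartInclusion h e e') (chartInclusion_surj h e e')
  rw [chartInclusion_top] at hrange hoff
  have hmid' : ∀ (x : Set.Iic p) i,
      midpoint (e' ⟨x.1, x.2.trans h⟩) (s i) = ε i * midpoint (e x) i := by
    intro x i
    rw [← chartInclusion_apply h e e' x, hmid]
  have hoff' : ∀ (x : Set.Iic p) t, (∀ i, s i ≠ t) →
      e' ⟨x.1, x.2.trans h⟩ t = e' ⟨p, h⟩ t := by
    intro x t ht
    rw [← chartInclusion_apply h e e' x, hoff _ t ht]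
  refine ⟨s, ε, hs, hε, fun i => funext fun t => ?_, hrange, hmid', hoff'⟩
  change midpoint _ t - midpoint _ t = _
  by_cases ht : ∃ i', s i' = t
  · obtain ⟨i', rfl⟩ := ht
    have h0 : midpoint (e' ⟨p, h⟩) (s i') = 0 := mid_eq_zero.mpr ((hrange _).mpr ⟨i', rfl⟩)
    rw [hmid', h0, e.apply_symm_apply, ← facet_true, midpoint_facet]
    by_cases hi : i' = i
    · subst hi
      simp [sgn]
    · simp [hi, hs.ne hi]
  · push Not at ht
    rw [Pi.single_eq_of_ne (ht i).symm]
    simp [midpoint, hoff' (e.symm (posFacet i)) t ht]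

/-- Changes of coordinates are affine. -/
theorem midpoint_eq_add_vecMul {p q : P} (h : p ≤ q) {j n : ℕ} (e : Set.Iic p ≃o Cube j)
    (e' : Set.Iic q ≃o Cube n) (x : Set.Iic p) :
    midpoint (e' ⟨x.1, x.2.trans h⟩) =
      midpoint (e' ⟨p, h⟩) + Matrix.vecMul (midpoint (e x)) (directions h e e') := by
  obtain ⟨s, ε, hs, hε, hdir, hrange, hmid, hoff⟩ := exists_directions h e e'
  funext t
  have hv : Matrix.vecMul (midpoint (e x)) (directions h e e') t =
      ∑ i, midpoint (e x) i * (Pi.single (s i) (ε i) : Fin n → ℤ) t := by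
    simp only [Matrix.vecMul, dotProduct, ← hdir]
  rw [Pi.add_apply, hv]
  by_cases ht : ∃ i', s i' = t
  · obtain ⟨i', rfl⟩ := ht
    have h0 : midpoint (e' ⟨p, h⟩) (s i') = 0 := mid_eq_zero.mpr ((hrange _).mpr ⟨i', rfl⟩)
    rw [hmid, h0, Finset.sum_eq_single i']
    · simp [mul_comm]
    · intro i _ hi
      simp [hs.ne hi.symm]
    · simp
  · push Not at ht
    rw [Finset.sum_eq_zero, add_zero, midpoint, midpoint, hoff x t ht]
    intro i _
    simp [(ht i).symm]

/-- The chain rule for the affine coordinate changes. It reduces every comparison of orientations to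
multiplicativity of determinants. -/
theorem directions_mul {p q r : P} (h : p ≤ q) (h' : q ≤ r) {i j n : ℕ} (e : Set.Iic p ≃o Cube i)
    (e' : Set.Iic q ≃o Cube j) (e'' : Set.Iic r ≃o Cube n) :
    directions h e e' * directions h' e' e'' = directions (h.trans h') e e'' := by
  refine Matrix.ext fun a t => congrFun (f := (_ : Matrix _ _ ℤ) a) (g := (_ : Matrix _ _ ℤ) a) ?_ t
  have h1 := midpoint_eq_add_vecMul h' e' e''
    ⟨(e.symm (posFacet a)).1, (e.symm (posFacet a)).2.trans h⟩
  have h2 := midpoint_eq_add_vecMul h' e' e'' ⟨p, h⟩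
  have h3 : (directions h e e' * directions h' e' e'') a =
      Matrix.vecMul (directions h e e' a) (directions h' e' e'') := rfl
  rw [h3]
  have h4 : directions h e e' a = midpoint (e' ⟨(e.symm (posFacet a)).1,
      (e.symm (posFacet a)).2.trans h⟩) - midpoint (e' ⟨p, h⟩) := rfl
  have h5 : directions (h.trans h') e e'' a = midpoint (e'' ⟨(e.symm (posFacet a)).1,
      (e.symm (posFacet a)).2.trans (h.trans h')⟩) - midpoint (e'' ⟨p, h.trans h'⟩) := rfl
  rw [h4, h5, Matrix.sub_vecMul, h1, h2]
  abel

theorem directions_self {p : P} {j : ℕ} (e : Set.Iic p ≃o Cube j) :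
    directions le_rfl e e = 1 := by
  refine Matrix.ext fun i t => ?_
  change (midpoint (e (e.symm (posFacet i))) - midpoint (e ⟨p, le_rfl⟩)) t = _
  have : (⟨p, le_rfl⟩ : Set.Iic p) = ⊤ := rfl
  rw [this, map_top, e.apply_symm_apply, midpoint_top, sub_zero, ← facet_true, midpoint_facet]
  simp [sgn, Matrix.one_apply, Pi.single_apply, eq_comm]

theorem det_directions {p : P} {j : ℕ} (e e' : Set.Iic p ≃o Cube j) :
    (directions le_rfl e e').det = 1 ∨ (directions le_rfl e e').det = -1 := by
  refine Int.isUnit_iff.mp (IsUnit.of_mul_eq_one (directions le_rfl e' e).det ?_)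
  rw [← Matrix.det_mul, directions_mul, directions_self, Matrix.det_one]

end

/-! ### Determinants -/

/-- The frame on the left is the block matrix diag(1, `M`) times the frame on the right. Thus
changing the frame of a facet by `M` multiplies its incidence number by `M.det`. -/
theorem det_cons_mul {n : ℕ} (v : Fin (n + 1) → ℤ) (M : Matrix (Fin n) (Fin n) ℤ)
    (A : Matrix (Fin n) (Fin (n + 1)) ℤ) :
    Matrix.det (Matrix.of (Fin.cons v (M * A) : Fin (n + 1) → Fin (n + 1) → ℤ)) =
      M.det * Matrix.det (Matrix.of (Fin.cons v A : Fin (n + 1) → Fin (n + 1) → ℤ)) := by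
  let N : Matrix (Fin (n + 1)) (Fin (n + 1)) ℤ :=
    Matrix.of (Fin.cons (Fin.cons 1 0) fun i => (Fin.cons 0 (M i) : Fin (n + 1) → ℤ))
  have hN : N.det = M.det := by
    rw [Matrix.det_succ_row_zero, Fin.sum_univ_succ]
    simp only [N, Matrix.of_apply, Fin.cons_zero, Fin.cons_succ]
    simp
    congr 1
  rw [← hN, ← Matrix.det_mul]
  congr 1
  ext i t
  refine Fin.cases ?_ (fun i => ?_) i
  · simp only [N, Matrix.mul_apply, Fin.sum_univ_succ, Matrix.of_apply, Fin.cons_zero,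
      Fin.cons_succ, Pi.zero_apply, zero_mul, Finset.sum_const_zero, one_mul, add_zero]
    rfl
  · simp only [N, Matrix.mul_apply, Fin.sum_univ_succ, Matrix.of_apply, Fin.cons_zero,
      Fin.cons_succ, zero_mul, zero_add]
    exact Matrix.mul_apply

theorem det_cons_cons_swap {n : ℕ} (u v : Fin (n + 2) → ℤ) (A : Fin n → Fin (n + 2) → ℤ) :
    Matrix.det (Matrix.of (Fin.cons u (Fin.cons v A) : Fin (n + 2) → Fin (n + 2) → ℤ)) =
      -Matrix.det (Matrix.of (Fin.cons v (Fin.cons u A) : Fin (n + 2) → Fin (n + 2) → ℤ)) := by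
  have h := Matrix.det_permute (Equiv.swap (0 : Fin (n + 2)) 1)
    (Matrix.of (Fin.cons v (Fin.cons u A) : Fin (n + 2) → Fin (n + 2) → ℤ))
  rw [Equiv.Perm.sign_swap (by simp)] at h
  simp only [Units.val_neg, Units.val_one, Int.cast_neg, Int.cast_one, neg_mul, one_mul] at h
  rw [← h]
  congr 1
  ext i t
  refine Fin.cases ?_ (fun i => Fin.cases ?_ (fun i => ?_) i) i
  · have h1 : Equiv.swap (0 : Fin (n + 2)) 1 0 = Fin.succ 0 := Equiv.swap_apply_left _ _
    simp only [Matrix.submatrix_apply, Matrix.of_apply, h1, Fin.cons_succ, Fin.cons_zero, id]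
  · have h1 : Equiv.swap (0 : Fin (n + 2)) 1 (Fin.succ 0) = 0 := Equiv.swap_apply_right _ _
    simp only [Matrix.submatrix_apply, Matrix.of_apply, h1, Fin.cons_succ, Fin.cons_zero, id]
  · have h1 : Equiv.swap (0 : Fin (n + 2)) 1 i.succ.succ = i.succ.succ :=
      Equiv.swap_apply_of_ne_of_ne (Fin.succ_ne_zero _)
        (by rw [← Fin.succ_zero_eq_one]; exact (Fin.succ_injective _).ne (Fin.succ_ne_zero _))
    simp only [Matrix.submatrix_apply, Matrix.of_apply, h1, Fin.cons_succ, id]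

end CubicalGarland

namespace CubicalGarland

open Wedge

section

variable {P : Type*} [PartialOrder P]

/-! ### Dimensions -/

theorem Face.ext {j : ℕ} {p q : Face P j} (h : p.1 = q.1) : p = q := Subtype.ext h

theorem Face.eq_of_chart {c : P} {n j : ℕ} (e : Set.Iic c ≃o Cube n) {p q : Face P j}
    {hp : p.1 ≤ c} {hq : q.1 ≤ c} (h : e ⟨p.1, hp⟩ = e ⟨q.1, hq⟩) : p = q :=
  Face.ext (Subtype.mk.inj (e.injective h))

/-- The free coordinates of a face are the injective image of its own coordinate directions, so
dimension can be read off in any chart of a larger face. -/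
theorem card_whole_eq {c : P} {n j : ℕ} (e : Set.Iic c ≃o Cube n) (p : Face P j) (h : p.1 ≤ c) :
    (Finset.univ.filter fun t => e ⟨p.1, h⟩ t = ⊤).card = j := by
  obtain ⟨e'⟩ := p.2
  obtain ⟨s, ε, hs, -, -, hrange, -⟩ := exists_directions h e' e
  have : (Finset.univ.filter fun t => e ⟨p.1, h⟩ t = ⊤) = Finset.univ.image s := by
    ext t
    simp [hrange]
  rw [this, Finset.card_image_of_injective _ hs, Finset.card_univ, Fintype.card_fin]

theorem Face.dim_le {i j : ℕ} {p : Face P i} {q : Face P j} (h : p.1 ≤ q.1) : i ≤ j := by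
  obtain ⟨e⟩ := q.2
  rw [← card_whole_eq e p h]
  exact (Finset.card_le_univ _).trans (Fintype.card_fin _).le

theorem Face.eq_of_le {j : ℕ} {p q : Face P j} (h : p.1 ≤ q.1) : p = q := by
  obtain ⟨e⟩ := q.2
  have h1 := card_whole_eq e p h
  have h2 : (Finset.univ.filter fun t => e ⟨p.1, h⟩ t = ⊤) = Finset.univ :=
    Finset.eq_univ_of_card _ (h1.trans (Fintype.card_fin _).symm)
  have h3 : e ⟨p.1, h⟩ = ⊤ := by
    funext t
    simpa using h2.ge (Finset.mem_univ t)
  rw [← map_top e] at h3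
  exact Face.ext (Subtype.mk.inj (e.injective h3))

theorem Face.lt_of_le {i j : ℕ} (hij : i ≠ j) {p : Face P i} {q : Face P j} (h : p.1 ≤ q.1) :
    p.1 < q.1 :=
  lt_of_le_of_ne h (Face.ne_of_ne hij p q)

theorem exists_face {c : P} {n j : ℕ} (hcub : IsCubical P) (e : Set.Iic c ≃o Cube n) (z : Cube n)
    (hz : (Finset.univ.filter fun t => z t = ⊤).card = j) :
    ∃ (p : Face P j) (h : p.1 ≤ c), e ⟨p.1, h⟩ = z := by
  obtain ⟨i, ⟨e'⟩⟩ := hcub (e.symm z).1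
  have h := card_whole_eq e (⟨(e.symm z).1, ⟨e'⟩⟩ : Face P i) (e.symm z).2
  have h' : e ⟨(e.symm z).1, (e.symm z).2⟩ = z := e.apply_symm_apply z
  rw [h', hz] at h
  subst h
  exact ⟨⟨(e.symm z).1, ⟨e'⟩⟩, (e.symm z).2, h'⟩

theorem card_whole_facet {n : ℕ} (t : Fin (n + 1)) (v : Bool) :
    (Finset.univ.filter fun t' => facet t v t' = ⊤).card = n := by
  have : (Finset.univ.filter fun t' => facet t v t' = ⊤) = {t}ᶜ := by
    ext t'
    by_cases h : t' = t
    · subst h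
      simp [endpoint_ne_top]
    · simp [facet_of_ne h, h]
  rw [this, Finset.card_compl, Fintype.card_fin, Finset.card_singleton, Nat.add_sub_cancel]

theorem exists_facet_face {c : P} {j : ℕ} (hcub : IsCubical P) (e : Set.Iic c ≃o Cube (j + 1))
    (t : Fin (j + 1)) (v : Bool) : ∃ (b : Face P j) (h : b.1 < c), e ⟨b.1, h.le⟩ = facet t v := by
  obtain ⟨b, h, hb⟩ := exists_face hcub e (facet t v) (card_whole_facet t v)
  refine ⟨b, lt_of_le_of_ne h ?_, hb⟩
  intro hbc
  have : (⟨b.1, h⟩ : Set.Iic c) = ⊤ := Subtype.ext hbc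
  rw [this, map_top] at hb
  exact (facet_lt_top t v).ne hb.symm

theorem exists_eq_facet {c : P} {j : ℕ} (e : Set.Iic c ≃o Cube (j + 1)) (b : Face P j)
    (h : b.1 ≤ c) : ∃ t v, e ⟨b.1, h⟩ = facet t v := by
  have h1 := card_whole_eq e b h
  obtain ⟨t, v, htv⟩ : ∃ t v, e ⟨b.1, h⟩ ≤ facet t v := by
    refine exists_le_facet fun htop => ?_
    simp [htop] at h1
  refine ⟨t, v, le_antisymm htv fun t' => ?_⟩
  by_cases ht : t' = t
  · subst ht
    rw [le_facet_iff.mp htv, facet_self]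
  · rw [facet_of_ne ht]
    by_contra hne
    rw [top_le_iff] at hne
    have h2 : (Finset.univ.filter fun t => e ⟨b.1, h⟩ t = ⊤) ⊆ {t, t'}ᶜ := by
      intro r hr
      simp only [Finset.mem_filter, Finset.mem_univ, true_and] at hr
      simp only [Finset.mem_compl, Finset.mem_insert, Finset.mem_singleton, not_or]
      constructor
      · rintro rfl
        rw [le_facet_iff.mp htv] at hr
        exact endpoint_ne_top _ hr
      · rintro rfl
        exact hne hr
    have h3 := Finset.card_le_card h2
    rw [h1, Finset.card_compl, Fintype.card_fin, Finset.card_pair (Ne.symm ht)] at h3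
    have := t.isLt
    have := t'.isLt
    have : t.val ≠ t'.val := fun h => ht (Fin.ext h.symm)
    omega

theorem eq_of_facet_lt {j : ℕ} {b : Face P j} {c : Face P (j + 1)} {x : P} (hbx : b.1 < x)
    (hxc : x ≤ c.1) : x = c.1 := by
  obtain ⟨e⟩ := c.2
  obtain ⟨t, v, hb⟩ := exists_eq_facet e b (hbx.le.trans hxc)
  by_contra hne
  have h1 : facet t v ≤ e ⟨x, hxc⟩ := by
    rw [← hb, e.le_iff_le]
    exact hbx.le
  have h2 := eq_facet_of_facet_le h1 fun htop => by
    rw [← map_top e] at htop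
    exact hne (congrArg Subtype.val (e.injective htop))
  rw [← hb] at h2
  exact hbx.ne' (congrArg Subtype.val (e.injective h2))

/-- Every lower bound of elements below `c` is itself below `c`, so meets in `P` can be computed in
a chart of `c`. -/
theorem isGLB_chart_iff {c : P} {n : ℕ} (e : Set.Iic c ≃o Cube n) {x y z : P} (hx : x ≤ c)
    (hy : y ≤ c) (hz : z ≤ c) :
    IsGLB {e ⟨x, hx⟩, e ⟨y, hy⟩} (e ⟨z, hz⟩) ↔ IsGLB {x, y} z := by
  have hl : ∀ (q : P) (hq : q ≤ c),
      e ⟨q, hq⟩ ∈ lowerBounds {e ⟨x, hx⟩, e ⟨y, hy⟩} ↔ q ∈ lowerBounds {x, y} := by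
    intro q hq
    simp only [lowerBounds, Set.mem_insert_iff, Set.mem_singleton_iff, forall_eq_or_imp, forall_eq,
      Set.mem_ofPred_eq, e.le_iff_le]
    exact Iff.rfl
  constructor
  · intro h
    refine ⟨(hl z hz).mp h.1, fun q hq => ?_⟩
    have hqc : q ≤ c := (hq (by simp : x ∈ ({x, y} : Set P))).trans hx
    have := h.2 ((hl q hqc).mpr hq)
    rwa [e.le_iff_le] at this
  · intro h
    refine ⟨(hl z hz).mpr h.1, fun q hq => ?_⟩
    obtain ⟨q, rfl⟩ := e.surjective q
    rw [e.le_iff_le]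
    exact h.2 ((hl q.1 q.2).mp hq)

/-! ### Incidence numbers -/

/-- Such a matrix is a signed permutation matrix, hence orthogonal. -/
theorem det_single {n : ℕ} {σ : Fin n → Fin n} (hσ : Function.Injective σ) {η : Fin n → ℤ}
    (hη : ∀ i, η i = 1 ∨ η i = -1) (Q : Matrix (Fin n) (Fin n) ℤ)
    (hQ : ∀ i, Q i = Pi.single (σ i) (η i)) : Q.det = 1 ∨ Q.det = -1 := by
  have h : Q * Q.transpose = 1 := by
    ext i i'
    rw [Matrix.mul_apply]
    simp only [Matrix.transpose_apply, hQ]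
    rw [Finset.sum_eq_single (σ i)]
    · by_cases hi : i = i'
      · subst hi
        rcases hη i with h | h <;> simp [h]
      · rw [Matrix.one_apply_ne hi, mul_eq_zero]
        exact Or.inr (Pi.single_eq_of_ne (hσ.ne hi) _)
    · intro t _ ht
      simp [ht]
    · simp
  have h' := congrArg Matrix.det h
  rw [Matrix.det_mul, Matrix.det_transpose, Matrix.det_one] at h'
  exact mul_self_eq_one_iff.mp h'

variable (χ : Charts P)

theorem incidence_eq {j : ℕ} {b : Face P j} {c : Face P (j + 1)} (h : b.1 < c.1) :
    incidence χ b c = Matrix.det (Matrix.of (Fin.cons (midpoint (χ (j + 1) c ⟨b.1, h.le⟩))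
      (directions h.le (χ j b) (χ (j + 1) c)) : Fin (j + 1) → Fin (j + 1) → ℤ)) :=
  dif_pos h

theorem incidence_sign {j : ℕ} {b : Face P j} {c : Face P (j + 1)} (h : b.1 < c.1) :
    incidence χ b c = 1 ∨ incidence χ b c = -1 := by
  rw [incidence_eq χ h]
  obtain ⟨s, ε, hs, hε, hdir, hrange, -⟩ := exists_directions h.le (χ j b) (χ (j + 1) c)
  obtain ⟨t, v, htv⟩ := exists_eq_facet (χ (j + 1) c) b h.le
  refine det_single (σ := Fin.cons t s) (η := Fin.cons (sgn v) ε) ?_ ?_ _ ?_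
  · rw [Fin.cons_injective_iff]
    refine ⟨?_, hs⟩
    rintro ⟨i, hi⟩
    have := (hrange t).mpr ⟨i, hi⟩
    rw [htv, facet_self] at this
    exact endpoint_ne_top _ this
  · intro i
    refine Fin.cases ?_ (fun i => ?_) i
    · exact sgn_eq v
    · exact hε i
  · intro i
    refine Fin.cases ?_ (fun i => ?_) i
    · change midpoint _ = Pi.single t (sgn v)
      rw [htv, midpoint_facet]
    · exact hdir i

theorem incidence_mul_self {j : ℕ} {b : Face P j} {c : Face P (j + 1)} (h : b.1 < c.1) :
    incidence χ b c * incidence χ b c = 1 :=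
  mul_self_eq_one_iff.mpr (incidence_sign χ h)

theorem det_mul_incidence {j : ℕ} {b : Face P j} {c : Face P (j + 1)} (h : b.1 < c.1)
    (M : Matrix (Fin j) (Fin j) ℤ) :
    M.det * incidence χ b c =
      Matrix.det (Matrix.of (Fin.cons (midpoint (χ (j + 1) c ⟨b.1, h.le⟩))
        (M * directions h.le (χ j b) (χ (j + 1) c)) : Fin (j + 1) → Fin (j + 1) → ℤ)) := by
  rw [incidence_eq χ h, det_cons_mul]

/-- Both incidence numbers are merged into one determinant in the coordinates of `c`: its rows are
the normal of `b` in `c`, the normal of `p` in `b`, and the directions of `p`. Only the order of the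
two normals depends on the route from `p` to `c`. -/
theorem incidence_mul_incidence {j : ℕ} {p : Face P j} {b : Face P (j + 1)} {c : Face P (j + 2)}
    (hp : p.1 < b.1) (hb : b.1 < c.1) :
    incidence χ p b * incidence χ b c =
      Matrix.det (Matrix.of (Fin.cons (midpoint (χ (j + 2) c ⟨b.1, hb.le⟩))
        (Fin.cons (midpoint (χ (j + 2) c ⟨p.1, (hp.trans hb).le⟩) -
            midpoint (χ (j + 2) c ⟨b.1, hb.le⟩))
          (directions (hp.trans hb).le (χ j p) (χ (j + 2) c))) :
            Fin (j + 2) → Fin (j + 2) → ℤ)) := by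
  rw [incidence_eq χ hp, det_mul_incidence χ hb]
  congr 3
  funext i
  refine Fin.cases ?_ (fun i => ?_) i
  · change Matrix.vecMul (midpoint _) _ = midpoint _ - midpoint _
    rw [midpoint_eq_add_vecMul hb.le (χ (j + 1) b) (χ (j + 2) c) ⟨p.1, hp.le⟩]
    abel
  · change _ = directions (hp.trans hb).le (χ j p) (χ (j + 2) c) i
    rw [← directions_mul hp.le hb.le (χ j p) (χ (j + 1) b) (χ (j + 2) c)]
    rfl

/-- The coboundary of the coboundary vanishes. -/
theorem incidence_cancel {j : ℕ} {p : Face P j} {b b' : Face P (j + 1)} {c : Face P (j + 2)}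
    (hb : b.1 < c.1) (hb' : b'.1 < c.1) (hne : b ≠ b') (hp : IsGLB {b.1, b'.1} p.1) :
    incidence χ p b * incidence χ b c = -(incidence χ p b' * incidence χ b' c) := by
  have hpb : p.1 < b.1 := Face.lt_of_le (by omega) (hp.1 (by simp))
  have hpb' : p.1 < b'.1 := Face.lt_of_le (by omega) (hp.1 (by simp))
  obtain ⟨t, v, htv⟩ := exists_eq_facet (χ (j + 2) c) b hb.le
  have hglb := (isGLB_chart_iff (χ (j + 2) c) hb.le hb'.le (hpb.trans hb).le).mpr hp
  -- The midpoint of the meet is the sum of the two facet midpoints. Hence the normal of `p` in `b`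
  -- is the normal of `b'` in `c`, and conversely.
  have hmid : midpoint (χ (j + 2) c ⟨p.1, (hpb.trans hb).le⟩) =
      midpoint (χ (j + 2) c ⟨b.1, hb.le⟩) + midpoint (χ (j + 2) c ⟨b'.1, hb'.le⟩) := by
    rw [htv] at hglb ⊢
    refine midpoint_of_isGLB hglb fun h => hne ?_
    rw [← htv, OrderIso.le_iff_le] at h
    exact (Face.eq_of_le h).symm
  rw [incidence_mul_incidence χ hpb hb, incidence_mul_incidence χ hpb' hb', hmid,
    add_sub_cancel_left, add_sub_cancel_right]
  exact det_cons_cons_swap _ _ _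

/-! ### Facets of a cube and the operation `⋈` -/

variable {m : ℕ}

theorem bowtie_eq_some_iff {b b' : Face P (m + 1)} {p : Face P m} :
    bowtie b b' = some p ↔ IsGLB {b.1, b'.1} p.1 := by
  unfold bowtie
  constructor
  · intro h
    split_ifs at h with h'
    cases h
    exact h'.choose_spec
  · intro h
    have h' : ∃ p : Face P m, IsGLB {b.1, b'.1} p.1 := ⟨p, h⟩
    rw [dif_pos h']
    exact congrArg some (Face.ext (h'.choose_spec.unique h))

theorem bowtie_eq_none_iff {b b' : Face P (m + 1)} :
    bowtie b b' = none ↔ ∀ p : Face P m, ¬ IsGLB {b.1, b'.1} p.1 := by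
  rw [Option.eq_none_iff_forall_ne_some]
  simp only [ne_eq, bowtie_eq_some_iff]

/-- Opposite facets of a cube have no common lower bound. -/
theorem opposite_facets_disjoint {c : P} (e : Set.Iic c ≃o Cube (m + 2)) {b b' : Face P (m + 1)}
    (hb : b.1 ≤ c) (hb' : b'.1 ≤ c) {t : Fin (m + 2)} {v : Bool} (h : e ⟨b.1, hb⟩ = facet t v)
    (h' : e ⟨b'.1, hb'⟩ = facet t (!v)) {x : P} (hx : x ≤ b.1) (hx' : x ≤ b'.1) : False := by
  have h1 : e ⟨x, hx.trans hb⟩ ≤ facet t v := by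
    rw [← h, e.le_iff_le]
    exact hx
  have h2 : e ⟨x, hx.trans hb⟩ ≤ facet t (!v) := by
    rw [← h', e.le_iff_le]
    exact hx'
  rw [le_facet_iff] at h1 h2
  have := endpoint_injective (h1.symm.trans h2)
  simp at this

/-- Distinct facets of a cube without a common facet are opposite. -/
theorem exists_opposite (hcub : IsCubical P) {c : P} (e : Set.Iic c ≃o Cube (m + 2))
    {b b' : Face P (m + 1)} (hb : b.1 ≤ c) (hb' : b'.1 ≤ c) (hne : b ≠ b')
    (h : bowtie b b' = none) {t : Fin (m + 2)} {v : Bool} (htv : e ⟨b.1, hb⟩ = facet t v) :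
    e ⟨b'.1, hb'⟩ = facet t (!v) := by
  obtain ⟨t', v', htv'⟩ := exists_eq_facet e b' hb'
  by_cases ht : t = t'
  · subst ht
    have hv : v' ≠ v := by
      rintro rfl
      exact hne (Face.eq_of_chart e (htv.trans htv'.symm))
    have : v' = !v := by
      revert hv
      cases v <;> cases v' <;> simp
    rw [htv', this]
  · exfalso
    have hglb := isGLB_facets ht v v'
    obtain ⟨p, hp, hpe⟩ := exists_face (j := m) hcub e
      (Function.update (facet t v) t' (endpoint v')) (by
        have : (Finset.univ.filter fun r => Function.update (facet t v) t' (endpoint v') r = ⊤) =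
            {t, t'}ᶜ := by
          ext r
          by_cases h1 : r = t'
          · subst h1
            simp [endpoint_ne_top]
          · by_cases h2 : r = t
            · subst h2
              simp [h1, endpoint_ne_top]
            · simp [h1, h2, facet_of_ne h2]
        rw [this, Finset.card_compl, Fintype.card_fin, Finset.card_pair ht, Nat.add_sub_cancel])
    rw [← hpe, ← htv, ← htv', isGLB_chart_iff] at hglb
    exact bowtie_eq_none_iff.mp h p hglb

/-- A vertex of the link graph and a cube above it determine a dart. -/
theorem existsUnique_dart (hcub : IsCubical P) (v : LinkVertex P m) (c : Face P (m + 2))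
    (h : v.face.1 < c.1) : ∃ d : Dart P m, (d.src = v ∧ d.top = c) ∧
      ∀ d' : Dart P m, d'.src = v → d'.top = c → d' = d := by
  obtain ⟨base, b, hlt⟩ := v
  dsimp only at h
  obtain ⟨e⟩ := c.2
  obtain ⟨t, u, hb⟩ := exists_eq_facet e b h.le
  suffices H : ∃ b' : Face P (m + 1), (b'.1 < c.1 ∧ b ≠ b' ∧ bowtie b b' = base) ∧
      ∀ b'' : Face P (m + 1), b''.1 < c.1 → b ≠ b'' → bowtie b b'' = base → b'' = b' by
    obtain ⟨b', ⟨h1, h2, h3⟩, h4⟩ := H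
    subst h3
    refine ⟨⟨b, b', c, h, h1, h2⟩, ⟨rfl, rfl⟩, ?_⟩
    rintro ⟨b₁, b₂, c', g1, g2, g3⟩ hs ht
    dsimp only at ht
    subst ht
    simp only [Dart.src, LinkVertex.mk.injEq] at hs
    obtain ⟨hs, rfl⟩ := hs
    have := h4 b₂ g2 g3 hs
    subst this
    rfl
  cases base with
  | none =>
    -- Over φ the partner of `b` in `c` is the opposite facet.
    obtain ⟨b', hb'c, hb'⟩ := exists_facet_face hcub e t (!u)
    refine ⟨b', ⟨hb'c, ?_, ?_⟩, ?_⟩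
    · rintro rfl
      exact opposite_facets_disjoint e h.le hb'c.le hb hb' le_rfl le_rfl
    · rw [bowtie_eq_none_iff]
      intro p hp
      exact opposite_facets_disjoint e h.le hb'c.le hb hb' (hp.1 (by simp)) (hp.1 (by simp))
    · intro b'' h1 h2 h3
      have := exists_opposite hcub e h.le h1.le h2 h3 hb
      rw [← hb'] at this
      exact Face.eq_of_chart e this
  | some p =>
    have hpb := hlt p rfl
    have hpc := hpb.trans h
    have hpt : e ⟨p.1, hpc.le⟩ t = endpoint u := by
      rw [← le_facet_iff, ← hb, e.le_iff_le]
      exact hpb.le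
    have hcard := card_whole_eq e p hpc.le
    -- Over a face `p` of codimension two in `c`, exactly two coordinates are fixed, so `p` lies in
    -- exactly two facets of `c`: `b` and its partner.
    have hcard' : (Finset.univ.filter fun r => e ⟨p.1, hpc.le⟩ r = ⊤)ᶜ.card = 2 := by
      rw [Finset.card_compl, Fintype.card_fin, hcard, Nat.add_sub_cancel_left]
    obtain ⟨t₁, t₂, h12, hset⟩ := Finset.card_eq_two.mp hcard'
    have hmem : ∀ r, e ⟨p.1, hpc.le⟩ r ≠ ⊤ ↔ r = t₁ ∨ r = t₂ := by
      intro r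
      have := Finset.ext_iff.mp hset r
      simpa using this
    obtain ⟨t', htt', hmem'⟩ : ∃ t', t ≠ t' ∧ ∀ r, e ⟨p.1, hpc.le⟩ r ≠ ⊤ ↔ r = t ∨ r = t' := by
      rcases (hmem t).mp (by rw [hpt]; exact endpoint_ne_top u) with rfl | rfl
      · exact ⟨t₂, h12, hmem⟩
      · exact ⟨t₁, h12.symm, fun r => (hmem r).trans or_comm⟩
    obtain ⟨u', hu'⟩ := exists_endpoint ((hmem' t').mpr (Or.inr rfl))
    have hpe : e ⟨p.1, hpc.le⟩ = Function.update (facet t u) t' (endpoint u') := by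
      funext r
      by_cases h1 : r = t'
      · subst h1
        simpa using hu'
      · by_cases h2 : r = t
        · subst h2
          simpa [h1] using hpt
        · rw [Function.update_of_ne h1, facet_of_ne h2]
          by_contra hr
          exact ((hmem' r).mp hr).elim h2 h1
    obtain ⟨b', hb'c, hb'⟩ := exists_facet_face hcub e t' u'
    refine ⟨b', ⟨hb'c, ?_, ?_⟩, ?_⟩
    · rintro rfl
      exact htt' (facet_injective (hb.symm.trans hb')).1
    · rw [bowtie_eq_some_iff, ← isGLB_chart_iff e h.le hb'c.le hpc.le, hpe, hb, hb']
      exact isGLB_facets htt' u u'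
    · intro b'' h1 h2 h3
      rw [bowtie_eq_some_iff] at h3
      obtain ⟨t'', u'', hb''⟩ := exists_eq_facet e b'' h1.le
      have h4 : e ⟨p.1, hpc.le⟩ t'' = endpoint u'' := by
        rw [← le_facet_iff, ← hb'', e.le_iff_le]
        exact h3.1 (by simp)
      have h5 : t'' = t' := by
        refine ((hmem' t'').mp (by rw [h4]; exact endpoint_ne_top _)).resolve_left ?_
        rintro rfl
        rw [hpt] at h4
        rw [← endpoint_injective h4, ← hb] at hb''
        exact h2 (Face.eq_of_chart e hb'').symm
      subst h5
      rw [hu'] at h4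
      rw [← endpoint_injective h4, ← hb'] at hb''
      exact Face.eq_of_chart e hb''

/-- Edges at a vertex correspond to cubes above its face. The degree is therefore independent of the
base, which is what makes the local norms add up to a multiple of the global one. -/
theorem LinkVertex.degree_eq (hcub : IsCubical P) (v : LinkVertex P m) :
    v.degree = topDegree m v.face := by
  refine Set.ncard_congr (fun d _ => d.top) ?_ ?_ ?_
  · rintro d rfl
    exact d.fst_lt.le
  · intro d d' hd hd' h
    obtain ⟨d₀, -, huniq⟩ := existsUnique_dart hcub v d.top (by
      rw [← hd]; exact d.fst_lt)
    rw [huniq d hd rfl, huniq d' hd' h.symm]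
  · intro c hc
    obtain ⟨d₀, h, -⟩ := existsUnique_dart hcub v c (Face.lt_of_le (by omega) hc)
    exact ⟨d₀, h.1, h.2⟩

theorem card_facets (hcub : IsCubical P) {j : ℕ} (c : Face P (j + 1)) :
    (Face.finite_below (i := j) c).toFinset.card = 2 * (j + 1) := by
  obtain ⟨e⟩ := c.2
  choose β hβ hβe using exists_facet_face hcub e
  have : (Finset.univ : Finset (Fin (j + 1) × Bool)).card = 2 * (j + 1) := by
    simp [mul_comm]
  rw [← this]
  symm
  refine Finset.card_bij (fun x _ => β x.1 x.2) ?_ ?_ ?_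
  · intro x _
    simpa using hβ x.1 x.2
  · intro x _ y _ hxy
    have h : facet x.1 x.2 = facet y.1 y.2 := by
      rw [← hβe, ← hβe]
      simp only [hxy]
    exact Prod.ext (facet_injective h).1 (facet_injective h).2
  · intro b hb
    have hb' : b.1 < c.1 := by simpa using hb
    obtain ⟨t, v, htv⟩ := exists_eq_facet e b hb'.le
    refine ⟨(t, v), Finset.mem_univ _, ?_⟩
    rw [← hβe] at htv
    exact (Face.eq_of_chart e htv).symm

/-- The vertices of the link graph over a face. -/
noncomputable def verticesOver (b : Face P (m + 1)) :
    Option {p : Face P m // p.1 < b.1} ≃ {v : LinkVertex P m // v.face = b} where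
  toFun o := ⟨⟨o.map Subtype.val, b, by
    rintro p hp
    obtain ⟨q, rfl, rfl⟩ := Option.map_eq_some_iff.mp hp
    exact q.2⟩, rfl⟩
  invFun v := v.1.base.pmap (fun p hp => ⟨p, hp⟩) fun p hp => v.2 ▸ v.1.lt p hp
  left_inv o := by
    cases o <;> simp
  right_inv := by
    rintro ⟨⟨base, b, hlt⟩, rfl⟩
    cases base <;> simp

instance finite_verticesOver (b : Face P (m + 1)) : Finite {v : LinkVertex P m // v.face = b} := by
  have : Finite {p : Face P m // p.1 < b.1} := (Face.finite_below (i := m) b).to_subtype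
  exact Finite.of_equiv _ (verticesOver b)

/-- The facets of a `k`-cube together with φ: the source of the constant 2k + 1. -/
theorem card_verticesOver (hcub : IsCubical P) (b : Face P (m + 1)) :
    Nat.card {v : LinkVertex P m // v.face = b} = 2 * (m + 1) + 1 := by
  have : Finite {p : Face P m // p.1 < b.1} := (Face.finite_below (i := m) b).to_subtype
  rw [← Nat.card_congr (verticesOver b), Finite.card_option, ← card_facets hcub b]
  congr 1
  exact Set.ncard_eq_toFinset_card {p : Face P m | p.1 < b.1} (Face.finite_below (i := m) b)

end

end CubicalGarland

namespace CubicalGarland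

open Wedge

section

variable {P : Type*} [PartialOrder P] {m : ℕ}

/-! ### Transversal components -/

/-- The vertex `(φ, b)`. -/
def LinkVertex.transversal (b : Face P (m + 1)) : LinkVertex P m := ⟨none, b, nofun⟩

theorem LinkVertex.isTransversal_iff (v : LinkVertex P m) :
    v.component.IsTransversal ↔ v.base = none :=
  Iff.rfl

theorem Dart.tgt_component (d : Dart P m) : d.tgt.component = d.src.component :=
  SimpleGraph.ConnectedComponent.connectedComponentMk_eq_of_adj
    ((linkGraph P m).symm.symm _ _ ⟨d, rfl, rfl⟩)

theorem Component.mem_carrier_of_le {a : Component P m} {x y : P} (hy : y ∈ a.carrier)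
    (h : x ≤ y) : x ∈ a.carrier := by
  obtain ⟨d, hd, hyd⟩ := hy
  exact ⟨d, hd, h.trans hyd⟩

theorem mem_carrier_of_lt (hcub : IsCubical P) (v : LinkVertex P m) {c : Face P (m + 2)}
    (h : v.face.1 < c.1) : c.1 ∈ v.component.carrier := by
  obtain ⟨d, ⟨rfl, rfl⟩, -⟩ := existsUnique_dart hcub v c h
  exact ⟨d, rfl, le_rfl⟩

/-- In a monodromy-free poset every `k`-face lies in a `(k+1)`-face. -/
theorem exists_cube_above (hmono : IsMonodromyFree P m) (b : Face P (m + 1)) :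
    ∃ c : Face P (m + 2), b.1 < c.1 := by
  by_contra! hno
  obtain ⟨Φ⟩ := hmono (LinkVertex.transversal b).component rfl
  have hb : b.1 ∈ (LinkVertex.transversal b).component.above := Or.inl ⟨b, ⟨_, rfl, rfl⟩, rfl⟩
  obtain ⟨d, hd, -⟩ := (Φ.symm (⟨b.1, hb⟩, ⊤)).2
  -- A walk from (φ, `b`) to `d.src` is either trivial, and then `d` starts at `b`, or has a first
  -- edge at `b`. Both put `b` into a cube.
  have hreach : (linkGraph P m).Reachable (LinkVertex.transversal b) d.src :=
    SimpleGraph.ConnectedComponent.exact (Eq.symm hd)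
  obtain ⟨q⟩ := hreach
  generalize hu : d.src = u at q
  cases q with
  | nil =>
    have h1 : d.fst = b := congrArg LinkVertex.face hu
    exact hno d.top (h1 ▸ d.fst_lt)
  | cons h _ =>
    obtain ⟨d', hd', -⟩ := h
    have h1 : d'.fst = b := congrArg LinkVertex.face hd'
    exact hno d'.top (h1 ▸ d'.fst_lt)

theorem Component.above_face {a : Component P m} (u : a.above) :
    (∃ b : Face P (m + 1), u.1 = b.1) ∨ ∃ c : Face P (m + 2), u.1 = c.1 := by
  obtain ⟨u, ⟨b, -, hb⟩ | ⟨-, c, -, -, hc⟩⟩ := u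
  · exact Or.inl ⟨b, hb⟩
  · exact Or.inr ⟨c, hc⟩

/-- Chains in `S_{>a}` have at most two elements. -/
theorem Component.above_eq_of_le {a : Component P m} {u s s' : a.above} (h : u ≤ s) (h' : s < s') :
    u = s := by
  have h : u.1 ≤ s.1 := h
  have h' : s.1 < s'.1 := h'
  rcases Component.above_face s with ⟨b, hb⟩ | ⟨c, hc⟩
  · rcases Component.above_face u with ⟨b', hb'⟩ | ⟨c', hc'⟩
    · rw [hb, hb'] at h
      exact Subtype.ext (by rw [hb, hb', Face.eq_of_le h])
    · rw [hb, hc'] at h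
      have := Face.dim_le h
      omega
  · exfalso
    rcases Component.above_face s' with ⟨b', hb'⟩ | ⟨c', hc'⟩
    · rw [hc, hb'] at h'
      have := Face.dim_le h'.le
      omega
    · rw [hc, hc'] at h'
      exact h'.ne (by rw [Face.eq_of_le h'.le])

theorem Component.eq_of_mem_carrier {a : Component P m} {c : Face P (m + 2)} {x : P}
    (hx : x ∈ a.carrier) (h : c.1 ≤ x) : x = c.1 := by
  obtain ⟨d, -, hd⟩ := hx
  have := Face.eq_of_le (h.trans hd)
  subst this
  exact le_antisymm hd h

/-! ### The product structure of P(a) and the transversal signs -/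

variable {a : Component P m} (Φ : a.carrier ≃o a.above × Cube (m + 1))

/-- Cubes are maximal in P(a), but raising the second coordinate to `⊤` gives an element above `c`.
-/
theorem snd_eq_top_of_cube {c : Face P (m + 2)} (hc : c.1 ∈ a.carrier) :
    (Φ ⟨c.1, hc⟩).2 = ⊤ := by
  have h1 : (⟨c.1, hc⟩ : a.carrier) ≤ Φ.symm ((Φ ⟨c.1, hc⟩).1, ⊤) := by
    rw [Φ.le_symm_apply]
    exact ⟨le_rfl, le_top⟩
  have h2 := Component.eq_of_mem_carrier (Φ.symm ((Φ ⟨c.1, hc⟩).1, ⊤)).2 h1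
  have h3 : Φ.symm ((Φ ⟨c.1, hc⟩).1, ⊤) = ⟨c.1, hc⟩ := Subtype.ext h2
  rw [Φ.symm_apply_eq] at h3
  exact (congrArg Prod.snd h3).symm

/-- The chart of a face of the product `S_{>a} × ⋀ᵏ` given by the second factor. -/
def IsProductChart (b : Face P (m + 1)) (e : Set.Iic b.1 ≃o Cube (m + 1)) : Prop :=
  ∀ x : Set.Iic b.1, ∃ hx : x.1 ∈ a.carrier, e x = (Φ ⟨x.1, hx⟩).2

theorem IsProductChart.snd_eq_top {b : Face P (m + 1)} {e : Set.Iic b.1 ≃o Cube (m + 1)}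
    (he : IsProductChart Φ b e) (hb : b.1 ∈ a.carrier) : (Φ ⟨b.1, hb⟩).2 = ⊤ := by
  obtain ⟨_, h⟩ := he ⊤
  rw [map_top] at h
  exact h.symm

theorem fst_lt_fst {b : Face P (m + 1)} {c : Face P (m + 2)} (h : b.1 < c.1)
    (hc : c.1 ∈ a.carrier) (hb : b.1 ∈ a.carrier) (htop : (Φ ⟨b.1, hb⟩).2 = ⊤) :
    (Φ ⟨b.1, hb⟩).1 < (Φ ⟨c.1, hc⟩).1 := by
  have h1 : Φ ⟨b.1, hb⟩ < Φ ⟨c.1, hc⟩ := by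
    rw [Φ.lt_iff_lt]
    exact h
  refine lt_of_le_of_ne h1.le.1 fun heq => h1.ne (Prod.ext heq ?_)
  rw [htop, snd_eq_top_of_cube]

/-- The first coordinate of `b` lies strictly below that of `c`, hence is minimal in S_{>a}. All
faces of `b` then share this first coordinate, so the second one alone is a chart. -/
theorem exists_isProductChart {b : Face P (m + 1)} {c : Face P (m + 2)} (h : b.1 < c.1)
    (hc : c.1 ∈ a.carrier) (hb : b.1 ∈ a.carrier) (htop : (Φ ⟨b.1, hb⟩).2 = ⊤) :
    ∃ e : Set.Iic b.1 ≃o Cube (m + 1), IsProductChart Φ b e := by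
  have hlt := fst_lt_fst Φ h hc hb htop
  have hmem : ∀ x : Set.Iic b.1, x.1 ∈ a.carrier := fun x => Component.mem_carrier_of_le hb x.2
  have hfst : ∀ x : Set.Iic b.1, (Φ ⟨x.1, hmem x⟩).1 = (Φ ⟨b.1, hb⟩).1 := by
    intro x
    have hle : Φ ⟨x.1, hmem x⟩ ≤ Φ ⟨b.1, hb⟩ := by
      rw [Φ.le_iff_le]
      exact x.2
    exact Component.above_eq_of_le hle.1 hlt
  have hinv : ∀ y, (Φ.symm ((Φ ⟨b.1, hb⟩).1, y)).1 ≤ b.1 := by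
    intro y
    have : Φ.symm ((Φ ⟨b.1, hb⟩).1, y) ≤ ⟨b.1, hb⟩ := by
      rw [Φ.symm_apply_le]
      exact ⟨le_rfl, by rw [htop]; exact le_top⟩
    exact this
  let e : Set.Iic b.1 ≃ Cube (m + 1) :=
    { toFun := fun x => (Φ ⟨x.1, hmem x⟩).2
      invFun := fun y => ⟨(Φ.symm ((Φ ⟨b.1, hb⟩).1, y)).1, hinv y⟩
      left_inv := by
        intro x
        apply Subtype.ext
        change (Φ.symm _).1 = _
        have : ((Φ ⟨b.1, hb⟩).1, (Φ ⟨x.1, hmem x⟩).2) = Φ ⟨x.1, hmem x⟩ :=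
          Prod.ext (hfst x).symm rfl
        rw [this, Φ.symm_apply_apply]
      right_inv := by
        intro y
        change (Φ (Φ.symm _)).2 = y
        rw [Φ.apply_symm_apply] }
  refine ⟨⟨e, ?_⟩, fun x => ⟨hmem x, rfl⟩⟩
  intro x y
  change (Φ ⟨x.1, hmem x⟩).2 ≤ (Φ ⟨y.1, hmem y⟩).2 ↔ x ≤ y
  have : x ≤ y ↔ Φ ⟨x.1, hmem x⟩ ≤ Φ ⟨y.1, hmem y⟩ := by
    rw [Φ.le_iff_le]
    exact Iff.rfl
  rw [this, Prod.le_def, hfst x, hfst y]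
  simp

/-- The directions of a product chart are the same for opposite facets of a cube. -/
theorem directions_isProductChart {b : Face P (m + 1)} {c : Face P (m + 2)} (h : b.1 < c.1)
    (hc : c.1 ∈ a.carrier) {e : Set.Iic b.1 ≃o Cube (m + 1)} (he : IsProductChart Φ b e)
    (e' : Set.Iic c.1 ≃o Cube (m + 2)) (i : Fin (m + 1))
    (hq : (Φ.symm ((Φ ⟨c.1, hc⟩).1, posFacet i)).1 ≤ c.1) :
    directions h.le e e' i = midpoint (e' ⟨(Φ.symm ((Φ ⟨c.1, hc⟩).1, posFacet i)).1, hq⟩) := by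
  have hb := Component.mem_carrier_of_le hc h.le
  have htop := he.snd_eq_top Φ hb
  have hlt := fst_lt_fst Φ h hc hb htop
  obtain ⟨t, v, htv⟩ := exists_eq_facet e' b h.le
  set x := e.symm (posFacet i) with hx
  set q := Φ.symm ((Φ ⟨c.1, hc⟩).1, posFacet i) with hqdef
  obtain ⟨hxc, hxe⟩ := he x
  have hΦq : Φ q = ((Φ ⟨c.1, hc⟩).1, posFacet i) := Φ.apply_symm_apply _
  have hΦx : Φ ⟨x.1, hxc⟩ = ((Φ ⟨b.1, hb⟩).1, posFacet i) := by
    have hle : Φ ⟨x.1, hxc⟩ ≤ Φ ⟨b.1, hb⟩ := by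
      rw [Φ.le_iff_le]
      exact x.2
    refine Prod.ext (Component.above_eq_of_le hle.1 hlt) ?_
    rw [← hxe, hx, e.apply_symm_apply]
  -- In the product, the positive facet `x` of `b` is the meet of `b` with `q`. Midpoints add under
  -- this meet, so the direction of `x` in `b` is the midpoint of `q`, and `q` depends only on `c`
  -- and `i`.
  have hglb : IsGLB {b.1, q.1} x.1 := by
    refine ⟨?_, fun y hy => ?_⟩
    · rintro y (rfl | rfl)
      · exact x.2
      · have : (⟨x.1, hxc⟩ : a.carrier) ≤ q := by
          rw [← Φ.le_iff_le, hΦx, hΦq]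
          exact ⟨hlt.le, le_rfl⟩
        exact this
    · have hyb : y ≤ b.1 := hy (by simp)
      have hyq : y ≤ q.1 := hy (by simp)
      have hyc := Component.mem_carrier_of_le hb hyb
      have h1 : Φ ⟨y, hyc⟩ ≤ Φ ⟨b.1, hb⟩ := by
        rw [Φ.le_iff_le]
        exact hyb
      have h2 : Φ ⟨y, hyc⟩ ≤ Φ q := by
        rw [Φ.le_iff_le]
        exact hyq
      rw [hΦq] at h2
      have h3 : (⟨y, hyc⟩ : a.carrier) ≤ ⟨x.1, hxc⟩ := by
        rw [← Φ.le_iff_le, hΦx]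
        exact ⟨h1.1, h2.2⟩
      exact h3
  have hmid : midpoint (e' ⟨x.1, x.2.trans h.le⟩) =
      midpoint (e' ⟨b.1, h.le⟩) + midpoint (e' ⟨q.1, hq⟩) := by
    rw [← isGLB_chart_iff e' h.le hq (x.2.trans h.le), htv] at hglb
    rw [htv]
    refine midpoint_of_isGLB hglb fun hle => ?_
    rw [← htv, e'.le_iff_le] at hle
    have h4 : q ≤ ⟨b.1, hb⟩ := hle
    rw [← Φ.le_iff_le, hΦq] at h4
    exact absurd h4.1 hlt.not_ge
  change midpoint (e' ⟨x.1, x.2.trans h.le⟩) - midpoint (e' ⟨b.1, h.le⟩) = _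
  rw [hmid, add_sub_cancel_left]

theorem det_cons_neg {n : ℕ} (u : Fin (n + 1) → ℤ) (A : Fin n → Fin (n + 1) → ℤ) :
    Matrix.det (Matrix.of (Fin.cons (-u) A : Fin (n + 1) → Fin (n + 1) → ℤ)) =
      -Matrix.det (Matrix.of (Fin.cons u A : Fin (n + 1) → Fin (n + 1) → ℤ)) := by
  have h := Matrix.det_updateRow_smul
    (Matrix.of (Fin.cons u A : Fin (n + 1) → Fin (n + 1) → ℤ)) 0 (-1) u
  have h1 : ∀ w, Matrix.updateRow (Matrix.of (Fin.cons u A : Fin (n + 1) → Fin (n + 1) → ℤ)) 0 w =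
      Matrix.of (Fin.cons w A : Fin (n + 1) → Fin (n + 1) → ℤ) := by
    intro w
    ext i t
    refine Fin.cases ?_ (fun i => ?_) i
    · simp
    · rw [Matrix.updateRow_ne (Fin.succ_ne_zero i)]
      simp
  rw [h1, h1] at h
  simpa using h

theorem midpoint_opposite {n : ℕ} (t : Fin n) (v : Bool) :
    midpoint (facet t (!v)) = -midpoint (facet t v) := by
  rw [midpoint_facet, midpoint_facet, sgn_not, Pi.single_neg]

/-- The sign of the vertex `(φ, b)` of `a`: if `b` is transversal to the product structure of
`P(a)`, the product orientation of `b`; otherwise `b` lies in a single cube. -/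
noncomputable def transversalSign (χ : Charts P) (b : Face P (m + 1)) : ℤ :=
  open Classical in
  if h : ∃ e, IsProductChart Φ b e then (directions le_rfl h.choose (χ (m + 1) b)).det
  else if h : ∃ c : Face P (m + 2), b.1 < c.1 then
    incidence χ b h.choose * ∑ t, midpoint (χ (m + 2) h.choose ⟨b.1, h.choose_spec.le⟩) t
  else 1

theorem transversalSign_of_not {χ : Charts P} {b : Face P (m + 1)} {c : Face P (m + 2)}
    (hno : ¬ ∃ e, IsProductChart Φ b e) (hbc : b.1 < c.1)
    (huniq : ∀ c' : Face P (m + 2), b.1 < c'.1 → c' = c) :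
    transversalSign Φ χ b = incidence χ b c * ∑ t, midpoint (χ (m + 2) c ⟨b.1, hbc.le⟩) t := by
  have h : ∃ c : Face P (m + 2), b.1 < c.1 := ⟨c, hbc⟩
  rw [transversalSign, dif_neg hno, dif_pos h]
  have : ∀ (c' : Face P (m + 2)) (h' : b.1 < c'.1), c' = c →
      incidence χ b c' * ∑ t, midpoint (χ (m + 2) c' ⟨b.1, h'.le⟩) t =
        incidence χ b c * ∑ t, midpoint (χ (m + 2) c ⟨b.1, hbc.le⟩) t := by
    rintro c' h' rfl
    rfl
  exact this _ h.choose_spec (huniq _ h.choose_spec)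

theorem sum_midpoint_facet {n : ℕ} (t : Fin n) (v : Bool) :
    ∑ t', midpoint (facet t v) t' = sgn v := by
  rw [midpoint_facet]
  simp

theorem transversalSign_sign (χ : Charts P) (b : Face P (m + 1)) :
    transversalSign Φ χ b = 1 ∨ transversalSign Φ χ b = -1 := by
  rw [transversalSign]
  split_ifs with h h'
  · exact det_directions _ _
  · obtain ⟨t, v, htv⟩ := exists_eq_facet (χ (m + 2) h'.choose) b h'.choose_spec.le
    rw [htv, sum_midpoint_facet]
    rcases incidence_sign χ h'.choose_spec with h1 | h1 <;> rcases sgn_eq v with h2 | h2 <;>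
      rw [h1, h2] <;> simp
  · exact Or.inl rfl

/-- A face that is not transversal to the product structure lies in a single cube. -/
theorem eq_of_not_isProductChart {b : Face P (m + 1)} {c : Face P (m + 2)}
    (hno : ¬ ∃ e, IsProductChart Φ b e) (hbc : b.1 < c.1) (hc : c.1 ∈ a.carrier)
    (hb : b.1 ∈ a.carrier) : Φ ⟨c.1, hc⟩ = ((Φ ⟨b.1, hb⟩).1, ⊤) := by
  have htop : (Φ ⟨b.1, hb⟩).2 ≠ ⊤ := fun h => hno (exists_isProductChart Φ hbc hc hb h)
  refine Prod.ext ?_ (snd_eq_top_of_cube Φ hc)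
  have hle : Φ ⟨b.1, hb⟩ ≤ Φ ⟨c.1, hc⟩ := by
    rw [Φ.le_iff_le]
    exact hbc.le
  set x := Φ.symm ((Φ ⟨b.1, hb⟩).1, ⊤) with hx
  have hΦx : Φ x = ((Φ ⟨b.1, hb⟩).1, ⊤) := Φ.apply_symm_apply _
  have hbx : (⟨b.1, hb⟩ : a.carrier) < x := by
    rw [← Φ.lt_iff_lt, hΦx]
    refine lt_of_le_of_ne ⟨le_rfl, le_top⟩ fun h => htop (congrArg Prod.snd h)
  have hxc : x ≤ ⟨c.1, hc⟩ := by
    rw [← Φ.le_iff_le, hΦx]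
    exact ⟨hle.1, (snd_eq_top_of_cube Φ hc).ge⟩
  have h := eq_of_facet_lt (b := b) (c := c) (x := x.1) hbx hxc
  have h' : x = ⟨c.1, hc⟩ := Subtype.ext h
  rw [← h', hΦx]

/-- For opposite facets the outward normals are negatives of each other. It remains to compare them
with the same tangent frame, which the product charts provide. A facet without a product chart lies
in the single cube `c`, and so does its opposite, so there the sign can be fixed inside `c` without
any compatibility condition. -/
theorem transversalSign_cancel (hcub : IsCubical P) (χ : Charts P) {d : Dart P m}
    (hd : d.src.component = a) (hbow : bowtie d.fst d.snd = none) :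
    transversalSign Φ χ d.fst * incidence χ d.fst d.top =
      -(transversalSign Φ χ d.snd * incidence χ d.snd d.top) := by
  obtain ⟨b, b', c, hb, hb', hne⟩ := d
  dsimp only at hbow ⊢
  have hmem : ∀ c' : Face P (m + 2), b.1 < c'.1 → c'.1 ∈ a.carrier := by
    intro c' h
    rw [← hd]
    exact mem_carrier_of_lt hcub _ h
  have hmem' : ∀ c' : Face P (m + 2), b'.1 < c'.1 → c'.1 ∈ a.carrier := by
    intro c' h
    rw [← hd, ← Dart.tgt_component]
    exact mem_carrier_of_lt hcub _ h
  have hc := hmem c hb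
  have hbc := Component.mem_carrier_of_le hc hb.le
  have hbc' := Component.mem_carrier_of_le hc hb'.le
  obtain ⟨t, v, htv⟩ := exists_eq_facet (χ (m + 2) c) b hb.le
  have htv' := exists_opposite hcub (χ (m + 2) c) hb.le hb'.le hne hbow htv
  have hdisj : ∀ x, x ≤ b.1 → x ≤ b'.1 → False := fun x =>
    opposite_facets_disjoint (χ (m + 2) c) hb.le hb'.le htv htv'
  -- Opposite facets have product charts simultaneously. If only `b₂` had one, the element with the
  -- first coordinate of `b₂` and the second of `b₁` would lie below both.
  have hor : ∀ b₁ b₂ : Face P (m + 1), b₁.1 < c.1 → b₂.1 < c.1 →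
      (∀ x, x ≤ b₁.1 → x ≤ b₂.1 → False) → (∃ e, IsProductChart Φ b₂ e) →
        ∃ e, IsProductChart Φ b₁ e := by
    rintro b₁ b₂ h₁ h₂ hdis ⟨e, he⟩
    by_contra hno
    have hm₁ := Component.mem_carrier_of_le hc h₁.le
    have hm₂ := Component.mem_carrier_of_le hc h₂.le
    have hΦc := eq_of_not_isProductChart Φ hno h₁ hc hm₁
    have hle : Φ ⟨b₂.1, hm₂⟩ ≤ Φ ⟨c.1, hc⟩ := by
      rw [Φ.le_iff_le]
      exact h₂.le
    rw [hΦc] at hle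
    set y := Φ.symm ((Φ ⟨b₂.1, hm₂⟩).1, (Φ ⟨b₁.1, hm₁⟩).2) with hy
    have hΦy : Φ y = ((Φ ⟨b₂.1, hm₂⟩).1, (Φ ⟨b₁.1, hm₁⟩).2) := Φ.apply_symm_apply _
    have h3 : y ≤ ⟨b₁.1, hm₁⟩ := by
      rw [← Φ.le_iff_le, hΦy]
      exact ⟨hle.1, le_rfl⟩
    have h4 : y ≤ ⟨b₂.1, hm₂⟩ := by
      rw [← Φ.le_iff_le, hΦy]
      exact ⟨le_rfl, by rw [he.snd_eq_top Φ hm₂]; exact le_top⟩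
    exact hdis y.1 h3 h4
  by_cases hI : ∃ e, IsProductChart Φ b e
  · have hI' := hor b' b hb' hb (fun x h h' => hdisj x h' h) hI
    have hq : ∀ i, (Φ.symm ((Φ ⟨c.1, hc⟩).1, posFacet i)).1 ≤ c.1 := by
      intro i
      have : Φ.symm ((Φ ⟨c.1, hc⟩).1, posFacet i) ≤ ⟨c.1, hc⟩ := by
        rw [Φ.symm_apply_le]
        exact ⟨le_rfl, by rw [snd_eq_top_of_cube]; exact le_top⟩
      exact this
    -- The product charts give both facets the same directions in `c`. After multiplicativity of
    -- determinants only the first row, the normal, differs, and it differs by a sign.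
    have hdir : directions hb.le hI.choose (χ (m + 2) c) =
        directions hb'.le hI'.choose (χ (m + 2) c) := by
      refine funext fun i => ?_
      rw [directions_isProductChart Φ hb hc hI.choose_spec _ i (hq i),
        directions_isProductChart Φ hb' hc hI'.choose_spec _ i (hq i)]
    rw [transversalSign, transversalSign, dif_pos hI, dif_pos hI', det_mul_incidence χ hb,
      det_mul_incidence χ hb', directions_mul, directions_mul, htv, htv', midpoint_opposite,
      hdir]
    exact (neg_eq_iff_eq_neg.mpr (det_cons_neg _ _)).symm
  · have hI' : ¬ ∃ e, IsProductChart Φ b' e := fun h => hI (hor b b' hb hb' hdisj h)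
    have huniq : ∀ c' : Face P (m + 2), b.1 < c'.1 → c' = c := by
      intro c' h
      have h1 := eq_of_not_isProductChart Φ hI h (hmem c' h) hbc
      rw [← eq_of_not_isProductChart Φ hI hb hc hbc] at h1
      exact Face.ext (Subtype.mk.inj (Φ.injective h1))
    have huniq' : ∀ c' : Face P (m + 2), b'.1 < c'.1 → c' = c := by
      intro c' h
      have h1 := eq_of_not_isProductChart Φ hI' h (hmem' c' h) hbc'
      rw [← eq_of_not_isProductChart Φ hI' hb' hc hbc'] at h1
      exact Face.ext (Subtype.mk.inj (Φ.injective h1))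
    rw [transversalSign_of_not Φ hI hb huniq, transversalSign_of_not Φ hI' hb' huniq', htv, htv',
      sum_midpoint_facet, sum_midpoint_facet, sgn_not]
    have h1 := incidence_mul_self χ hb
    have h2 := incidence_mul_self χ hb'
    linear_combination sgn v * h1 - sgn v * h2

end

/-! ### Existence of Garland orientations -/

section

variable {P : Type*} [PartialOrder P] {m : ℕ}

theorem exists_garlandOrientation (hcub : IsCubical P) (hmono : IsMonodromyFree P m)
    (χ : Charts P) : ∃ w : LinkVertex P m → ℤ, IsGarlandOrientation χ w := by
  classical
  let Φ : ∀ a : Component P m, a.IsTransversal → (a.carrier ≃o a.above × Cube (m + 1)) :=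
    fun a ha => (hmono a ha).some
  -- The default value 1 is never used: a vertex without a base lies in a transversal component.
  let w : LinkVertex P m → ℤ := fun v =>
    if h : v.component.IsTransversal then transversalSign (Φ _ h) χ v.face
    else v.base.elim 1 fun p => incidence χ p v.face
  have hsome : ∀ (v : LinkVertex P m) (p : Face P m), v.base = some p →
      w v = incidence χ p v.face := by
    intro v p hp
    have h : ¬ v.component.IsTransversal := by
      rw [v.isTransversal_iff, hp]
      simp
    simp only [w]
    rw [dif_neg h, hp]
    rfl
  have hnone : ∀ (a : Component P m) (ha : a.IsTransversal) (v : LinkVertex P m),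
      v.component = a → w v = transversalSign (Φ a ha) χ v.face := by
    rintro _ ha v rfl
    exact dif_pos ha
  refine ⟨w, ?_, hsome, ?_⟩
  · intro v
    cases h : v.base with
    | none =>
      rw [hnone v.component h v rfl]
      exact transversalSign_sign _ _ _
    | some p =>
      rw [hsome v p h]
      exact incidence_sign χ (v.lt p h)
  · intro d
    cases h : bowtie d.fst d.snd with
    | none =>
      have ha : d.src.component.IsTransversal := h
      rw [hnone _ ha d.src rfl, hnone _ ha d.tgt d.tgt_component]
      exact transversalSign_cancel (Φ _ ha) hcub χ rfl h
    | some p =>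
      rw [hsome d.src p h, hsome d.tgt p h]
      exact incidence_cancel χ d.fst_lt d.snd_lt d.ne (bowtie_eq_some_iff.mp h)

end

end CubicalGarland

namespace CubicalGarland

/-! ### Operators between weighted `ℓ²`-spaces -/

section Hilbert

open ContinuousLinearMap

variable {X Y : Type*} [NormedAddCommGroup X] [InnerProductSpace ℝ X] [CompleteSpace X]
  [NormedAddCommGroup Y] [InnerProductSpace ℝ Y] [CompleteSpace Y]

/-- Lax–Milgram: the form ⟨T T* y, z⟩ is coercive, so T T* is onto. -/
theorem surjective_of_adjoint_bounded_below (T : X →L[ℝ] Y) {ε : ℝ} (hε : 0 < ε)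
    (h : ∀ y, ε * ‖y‖ ^ 2 ≤ ‖adjoint T y‖ ^ 2) : Function.Surjective T := by
  let B : Y →L[ℝ] Y →L[ℝ] ℝ := (innerSL ℝ).comp (T.comp (adjoint T))
  have hB : ∀ y z, B y z = inner ℝ (T (adjoint T y)) z := fun y z => rfl
  have hco : IsCoercive B := by
    refine ⟨ε, hε, fun y => ?_⟩
    rw [hB, ← adjoint_inner_right, real_inner_self_eq_norm_sq, mul_assoc, ← pow_two]
    exact h y
  intro y
  obtain ⟨z, rfl⟩ := hco.continuousLinearEquivOfBilin.surjective y
  refine ⟨adjoint T z, ext_inner_right ℝ fun u => ?_⟩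
  rw [hco.continuousLinearEquivOfBilin_apply, hB]

/-- The orthogonal complement of the range is the kernel of the adjoint. -/
theorem denseRange_of_adjoint_injective (T : X →L[ℝ] Y) (h : ∀ y, adjoint T y = 0 → y = 0) :
    DenseRange T := by
  have h1 : (T.range)ᗮ = ⊥ := by
    rw [orthogonal_range, eq_bot_iff]
    exact fun y hy => h y hy
  rw [← Submodule.topologicalClosure_eq_top_iff] at h1
  have h2 := (Submodule.dense_iff_topologicalClosure_eq_top (s := T.range)).mpr h1
  have h3 : (T.range : Set Y) = Set.range T := LinearMap.coe_range _
  rwa [h3] at h2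

end Hilbert

section

variable {ι : Type*} {ω : ι → ℕ}

/-- The isometry of `ℓ²` with a weighted `ℓ²`-space. -/
noncomputable def unscale (ω : ι → ℕ) : lp (fun _ : ι => ℝ) 2 →ₗ[ℝ] (ι → ℝ) where
  toFun F i := F i / √(ω i)
  map_add' F G := by
    funext i
    simp [add_div]
  map_smul' r F := by
    funext i
    simp [mul_div_assoc]

theorem unscale_apply (F : lp (fun _ : ι => ℝ) 2) (i : ι) : unscale ω F i = F i / √(ω i) := rfl

theorem continuous_unscale : Continuous (unscale ω) := by
  refine continuous_pi fun i => ?_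
  exact (lp.evalCLM ℝ (fun _ : ι => ℝ) 2 i).continuous.div_const _

theorem unscale_mul (hω : ∀ i, 0 < ω i) (F G : lp (fun _ : ι => ℝ) 2) (i : ι) :
    (ω i : ℝ) * (unscale ω F i * unscale ω G i) = F i * G i := by
  have h : (0 : ℝ) < ω i := Nat.cast_pos.mpr (hω i)
  have h' : √(ω i : ℝ) ≠ 0 := (Real.sqrt_pos.mpr h).ne'
  rw [unscale_apply, unscale_apply, div_mul_div_comm, Real.mul_self_sqrt h.le]
  field_simp

theorem inner_eq_tsum_unscale (hω : ∀ i, 0 < ω i) (F G : lp (fun _ : ι => ℝ) 2) :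
    inner ℝ F G = ∑' i, (ω i : ℝ) * (unscale ω F i * unscale ω G i) := by
  rw [lp.inner_eq_tsum]
  refine tsum_congr fun i => ?_
  rw [unscale_mul hω]
  simp [mul_comm]

theorem norm_sq_eq_tsum_unscale (hω : ∀ i, 0 < ω i) (F : lp (fun _ : ι => ℝ) 2) :
    ‖F‖ ^ 2 = ∑' i, (ω i : ℝ) * unscale ω F i ^ 2 := by
  rw [← real_inner_self_eq_norm_sq, inner_eq_tsum_unscale hω]
  simp only [pow_two]

theorem unscale_mem (hω : ∀ i, 0 < ω i) (F : lp (fun _ : ι => ℝ) 2) :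
    unscale ω F ∈ weightedL2 ω := by
  change Summable _
  refine (lp.summable_inner (𝕜 := ℝ) F F).congr fun i => ?_
  rw [pow_two, unscale_mul hω]
  simp [pow_two]

/-- The inverse of `unscale`. -/
noncomputable def rescale (ω : ι → ℕ) : weightedL2 ω →ₗ[ℝ] lp (fun _ : ι => ℝ) 2 where
  toFun f := ⟨fun i => √(ω i) * f.1 i, by
    refine (memℓp_gen_iff (by norm_num)).mpr (Summable.congr f.2 fun i => ?_)
    simp [mul_pow]⟩
  map_add' f g := by
    ext i
    exact mul_add _ _ _
  map_smul' r f := by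
    ext i
    simp [mul_left_comm]

theorem unscale_rescale (hω : ∀ i, 0 < ω i) (f : weightedL2 ω) : unscale ω (rescale ω f) = f.1 := by
  funext i
  have h : (0 : ℝ) < ω i := Nat.cast_pos.mpr (hω i)
  have h' : √(ω i : ℝ) ≠ 0 := (Real.sqrt_pos.mpr h).ne'
  change √(ω i) * f.1 i / √(ω i) = _
  field_simp

theorem unscale_injective (hω : ∀ i, 0 < ω i) : Function.Injective (unscale ω) := by
  intro F G h
  ext i
  have h0 : (0 : ℝ) < ω i := Nat.cast_pos.mpr (hω i)
  have h' : √(ω i : ℝ) ≠ 0 := (Real.sqrt_pos.mpr h0).ne'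
  exact (div_left_inj' h').mp (congrFun h i)

end

section

variable {A B : Type*} {vol : A → ℕ} {n : B → ℕ}

/-- A bounded operator `D` between weighted `ℓ²`-spaces that takes values in a closed subspace `Z`
is surjective onto `Z` if its adjoint `M` is bounded below on `Z`, and has dense range in `Z` if `M`
is injective on `Z`. -/
theorem weighted_range (hvol : ∀ a, 0 < vol a) (hn : ∀ b, 0 < n b)
    (D : (A → ℝ) →ₗ[ℝ] (B → ℝ)) (M : (B → ℝ) → A → ℝ) (Z : Submodule ℝ (B → ℝ))
    (hZ : IsClosed (Z : Set (B → ℝ)))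
    (hDmem : ∀ g ∈ weightedL2 vol, D g ∈ weightedL2 n) (hDZ : ∀ g ∈ weightedL2 vol, D g ∈ Z)
    {C : ℝ} (hC : ∀ g ∈ weightedL2 vol,
      ∑' b, (n b : ℝ) * D g b ^ 2 ≤ C * ∑' a, (vol a : ℝ) * g a ^ 2)
    (hMmem : ∀ f ∈ weightedL2 n, M f ∈ weightedL2 vol)
    (hadj : ∀ f ∈ weightedL2 n, ∀ g ∈ weightedL2 vol,
      ∑' b, (n b : ℝ) * (f b * D g b) = ∑' a, (vol a : ℝ) * (M f a * g a)) :
    ((∃ ε : ℝ, 0 < ε ∧ ∀ f ∈ weightedL2 n ⊓ Z,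
        ε * ∑' b, (n b : ℝ) * f b ^ 2 ≤ ∑' a, (vol a : ℝ) * M f a ^ 2) →
      ∀ f ∈ weightedL2 n ⊓ Z, ∃ g ∈ weightedL2 vol, D g = f) ∧
    ((∀ f ∈ weightedL2 n ⊓ Z, M f = 0 → f = 0) →
      ∀ f ∈ weightedL2 n ⊓ Z, ∀ ε : ℝ, 0 < ε →
        ∃ g ∈ weightedL2 vol, ∑' b, (n b : ℝ) * (f b - D g b) ^ 2 < ε) := by
  let Z' : Submodule ℝ (lp (fun _ : B => ℝ) 2) := Z.comap (unscale n)
  have hZ' : IsClosed (Z' : Set (lp (fun _ : B => ℝ) 2)) := hZ.preimage continuous_unscale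
  have : CompleteSpace Z' := hZ'.completeSpace_coe
  let T₀ : lp (fun _ : A => ℝ) 2 →ₗ[ℝ] Z' :=
    ((rescale n).comp ((D.comp (unscale vol)).codRestrict (weightedL2 n)
      fun G => hDmem _ (unscale_mem hvol G))).codRestrict Z' fun G => by
        change unscale n _ ∈ Z
        rw [LinearMap.comp_apply, unscale_rescale hn]
        exact hDZ _ (unscale_mem hvol G)
  have hT₀ : ∀ G, unscale n (T₀ G).1 = D (unscale vol G) := fun G => unscale_rescale hn _
  let T : lp (fun _ : A => ℝ) 2 →L[ℝ] Z' := T₀.mkContinuous √C fun G => by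
    have h := hC _ (unscale_mem hvol G)
    rw [← hT₀, ← norm_sq_eq_tsum_unscale hn, ← norm_sq_eq_tsum_unscale hvol] at h
    rw [← Real.sqrt_sq (norm_nonneg G), ← Real.sqrt_mul' C (sq_nonneg _)]
    exact Real.le_sqrt_of_sq_le h
  have hT : ∀ G, unscale n (T G).1 = D (unscale vol G) := hT₀
  have hmem : ∀ F : Z', unscale n F.1 ∈ weightedL2 n := fun F => unscale_mem hn _
  -- The adjointness relation `hadj` identifies the Hilbert space adjoint of the restricted operator
  -- with `M` on `Z`.
  have hadjT : ∀ F : Z', unscale vol (ContinuousLinearMap.adjoint T F) = M (unscale n F.1) := by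
    intro F
    refine Eq.trans (congrArg (unscale vol) ?_)
      (unscale_rescale hvol ⟨M (unscale n F.1), hMmem _ (hmem F)⟩)
    refine ext_inner_right ℝ fun G => ?_
    rw [ContinuousLinearMap.adjoint_inner_left, Submodule.coe_inner, inner_eq_tsum_unscale hn, hT,
      hadj _ (hmem F) _ (unscale_mem hvol G), inner_eq_tsum_unscale hvol, unscale_rescale hvol]
  have hlift : ∀ f ∈ weightedL2 n ⊓ Z, ∃ F : Z', unscale n F.1 = f := by
    intro f hf
    refine ⟨⟨rescale n ⟨f, hf.1⟩, ?_⟩, unscale_rescale hn _⟩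
    change unscale n _ ∈ Z
    rw [unscale_rescale hn]
    exact hf.2
  constructor
  · rintro ⟨ε, hε, h⟩ f hf
    have hsurj : Function.Surjective T := by
      refine surjective_of_adjoint_bounded_below T hε fun F => ?_
      rw [norm_sq_eq_tsum_unscale hvol, hadjT, ← Submodule.norm_coe,
        norm_sq_eq_tsum_unscale hn]
      exact h _ ⟨hmem F, F.2⟩
    obtain ⟨F, rfl⟩ := hlift f hf
    obtain ⟨G, rfl⟩ := hsurj F
    exact ⟨unscale vol G, unscale_mem hvol G, (hT G).symm⟩
  · intro h f hf ε hε
    have hdense : DenseRange T := by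
      refine denseRange_of_adjoint_injective T fun F hF => ?_
      have h1 := hadjT F
      rw [hF, map_zero] at h1
      have h2 := h _ ⟨hmem F, F.2⟩ h1.symm
      rw [← map_zero (unscale n)] at h2
      exact Subtype.ext (unscale_injective hn h2)
    obtain ⟨F, rfl⟩ := hlift f hf
    obtain ⟨G, hG⟩ := hdense.exists_dist_lt F (Real.sqrt_pos.mpr hε)
    refine ⟨unscale vol G, unscale_mem hvol G, ?_⟩
    rw [dist_eq_norm, ← Submodule.norm_coe] at hG
    have h3 := (Real.lt_sqrt (norm_nonneg _)).mp hG
    rw [norm_sq_eq_tsum_unscale hn, Submodule.coe_sub, map_sub, hT] at h3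
    exact h3

end

/-! ### Sums over fibres -/

section

variable {ι κ : Type*}

theorem tsum_coe_eq_sum {s : Set ι} (hs : s.Finite) (F : ι → ℝ) :
    ∑' i : s, F i = ∑ i ∈ hs.toFinset, F i := by
  have := hs.fintype
  rw [tsum_fintype, Finset.sum_subtype hs.toFinset (p := fun i => i ∈ s) (by simp)]

variable (π : ι → κ) (hπ : ∀ k, (π ⁻¹' {k}).Finite)

theorem summable_iff_fiberwise {F : ι → ℝ} (hF : ∀ i, 0 ≤ F i) :
    Summable F ↔ Summable fun k => ∑ i ∈ (hπ k).toFinset, F i := by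
  rw [summable_partition (s := fun k => π ⁻¹' {k}) hF fun i => ⟨π i, rfl, fun k hk => hk.symm⟩]
  simp only [fun k => tsum_coe_eq_sum (hπ k) F]
  refine and_iff_right fun k => ?_
  have := (hπ k).to_subtype
  exact Summable.of_finite

theorem hasSum_fiberwise {F : ι → ℝ} (hF : Summable F) :
    HasSum (fun k => ∑ i ∈ (hπ k).toFinset, F i) (∑' i, F i) := by
  have h := hF.hasSum.tsum_fiberwise π
  simpa only [fun k => tsum_coe_eq_sum (hπ k) F] using h

end

/-! ### The operators of a two-sided fibration -/

section

variable {V A B : Type*} {face : V → B} {comp : V → A} (hface : ∀ b, (face ⁻¹' {b}).Finite)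
  (hcomp : ∀ a, (comp ⁻¹' {a}).Finite) {n : B → ℕ} {vol : A → ℕ} {w : V → ℝ} {q : ℕ}

/-- The weighted mean over the fibres of `comp`. -/
noncomputable def fiberMean (n : B → ℕ) (vol : A → ℕ) (w : V → ℝ) (f : B → ℝ) (a : A) : ℝ :=
  (∑ v ∈ (hcomp a).toFinset, (n (face v) : ℝ) * (w v * f (face v))) / vol a

/-- The signed sum over the fibres of `face`. -/
noncomputable def fiberSum (comp : V → A) (w : V → ℝ) (g : A → ℝ) (b : B) : ℝ :=
  ∑ v ∈ (hface b).toFinset, w v * g (comp v)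

theorem hasSum_pullback_comp (hvol : ∀ a, vol a = ∑ v ∈ (hcomp a).toFinset, n (face v))
    {g : A → ℝ} (hg : g ∈ weightedL2 vol) :
    HasSum (fun v => (n (face v) : ℝ) * g (comp v) ^ 2) (∑' a, (vol a : ℝ) * g a ^ 2) := by
  have hfib : ∀ a, ∑ v ∈ (hcomp a).toFinset, (n (face v) : ℝ) * g (comp v) ^ 2 =
      (vol a : ℝ) * g a ^ 2 := by
    intro a
    rw [hvol, Nat.cast_sum, Finset.sum_mul]
    refine Finset.sum_congr rfl fun v hv => ?_
    have : comp v = a := by simpa using hv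
    rw [this]
  have hs : Summable fun v => (n (face v) : ℝ) * g (comp v) ^ 2 := by
    rw [summable_iff_fiberwise comp hcomp fun v => by positivity]
    simp only [hfib]
    exact hg
  have h := hasSum_fiberwise comp hcomp hs
  simp only [hfib] at h
  rw [h.tsum_eq]
  exact hs.hasSum

theorem hasSum_pullback_face (hq : ∀ b, (hface b).toFinset.card = q) {f : B → ℝ}
    (hf : f ∈ weightedL2 n) :
    HasSum (fun v => (n (face v) : ℝ) * f (face v) ^ 2) (q * ∑' b, (n b : ℝ) * f b ^ 2) := by
  have hfib : ∀ b, ∑ v ∈ (hface b).toFinset, (n (face v) : ℝ) * f (face v) ^ 2 =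
      q * ((n b : ℝ) * f b ^ 2) := by
    intro b
    rw [← hq b, ← nsmul_eq_mul, ← Finset.sum_const]
    refine Finset.sum_congr rfl fun v hv => ?_
    have : face v = b := by simpa using hv
    rw [this]
  have hs : Summable fun v => (n (face v) : ℝ) * f (face v) ^ 2 := by
    rw [summable_iff_fiberwise face hface fun v => by positivity]
    simp only [hfib]
    exact Summable.mul_left _ hf
  have h := hasSum_fiberwise face hface hs
  simp only [hfib] at h
  rw [← tsum_mul_left, h.tsum_eq]
  exact hs.hasSum

/-- Cauchy–Schwarz for a sum of `q` terms; this yields the bound `q` for the squared norm of the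
operator. -/
theorem sq_fiberSum_le (hq : ∀ b, (hface b).toFinset.card = q) (hw : ∀ v, w v ^ 2 = 1)
    (g : A → ℝ) (b : B) : (n b : ℝ) * fiberSum hface comp w g b ^ 2 ≤
      q * ∑ v ∈ (hface b).toFinset, (n (face v) : ℝ) * g (comp v) ^ 2 := by
  have h1 : ∑ v ∈ (hface b).toFinset, (n (face v) : ℝ) * g (comp v) ^ 2 =
      n b * ∑ v ∈ (hface b).toFinset, (w v * g (comp v)) ^ 2 := by
    rw [Finset.mul_sum]
    refine Finset.sum_congr rfl fun v hv => ?_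
    have : face v = b := by simpa using hv
    rw [this, mul_pow, hw, one_mul]
  rw [h1, ← hq b, mul_left_comm]
  exact mul_le_mul_of_nonneg_left sq_sum_le_card_mul_sum_sq (Nat.cast_nonneg _)

theorem fiberSum_mem (hvol : ∀ a, vol a = ∑ v ∈ (hcomp a).toFinset, n (face v))
    (hq : ∀ b, (hface b).toFinset.card = q) (hw : ∀ v, w v ^ 2 = 1) {g : A → ℝ}
    (hg : g ∈ weightedL2 vol) : fiberSum hface comp w g ∈ weightedL2 n ∧
      ∑' b, (n b : ℝ) * fiberSum hface comp w g b ^ 2 ≤ q * ∑' a, (vol a : ℝ) * g a ^ 2 := by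
  have h := hasSum_pullback_comp hcomp hvol hg
  have h1 := (hasSum_fiberwise face hface h.summable).mul_left (q : ℝ)
  have h2 : fiberSum hface comp w g ∈ weightedL2 n :=
    Summable.of_nonneg_of_le (fun b => by positivity) (sq_fiberSum_le hface hq hw g) h1.summable
  refine ⟨h2, ?_⟩
  rw [← h.tsum_eq, ← h1.tsum_eq]
  exact Summable.tsum_le_tsum (sq_fiberSum_le hface hq hw g) h2 h1.summable

/-- Weighted Cauchy–Schwarz on a fibre of total weight `vol a`. -/
theorem sq_fiberMean_le (hvol : ∀ a, vol a = ∑ v ∈ (hcomp a).toFinset, n (face v))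
    (hw : ∀ v, w v ^ 2 = 1) (f : B → ℝ) (a : A) :
    (vol a : ℝ) * fiberMean (face := face) hcomp n vol w f a ^ 2 ≤
      ∑ v ∈ (hcomp a).toFinset, (n (face v) : ℝ) * f (face v) ^ 2 := by
  have h1 := Finset.sum_sq_le_sum_mul_sum_of_sq_le_mul (hcomp a).toFinset
    (r := fun v => (n (face v) : ℝ) * (w v * f (face v))) (f := fun v => (n (face v) : ℝ))
    (g := fun v => (n (face v) : ℝ) * f (face v) ^ 2) (fun v _ => by positivity)
    (fun v _ => by positivity) (fun v _ => by
      rw [mul_pow, mul_pow, hw]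
      exact le_of_eq (by ring))
  rw [← Nat.cast_sum, ← hvol] at h1
  rw [fiberMean, div_pow]
  rcases Nat.eq_zero_or_pos (vol a) with h0 | h0
  · rw [h0, Nat.cast_zero, zero_mul]
    exact Finset.sum_nonneg fun v _ => by positivity
  · have h0' : (0 : ℝ) < vol a := Nat.cast_pos.mpr h0
    rw [mul_div_assoc', div_le_iff₀ (by positivity), pow_two (vol a : ℝ), ← mul_assoc,
      mul_comm _ (vol a : ℝ), mul_comm (∑ v ∈ (hcomp a).toFinset, (n (face v) : ℝ) * _)]
    exact mul_le_mul_of_nonneg_left h1 h0'.le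

theorem fiberMean_mem (hvol : ∀ a, vol a = ∑ v ∈ (hcomp a).toFinset, n (face v))
    (hq : ∀ b, (hface b).toFinset.card = q) (hw : ∀ v, w v ^ 2 = 1) {f : B → ℝ}
    (hf : f ∈ weightedL2 n) : fiberMean (face := face) hcomp n vol w f ∈ weightedL2 vol :=
  Summable.of_nonneg_of_le (fun b => by positivity) (sq_fiberMean_le hcomp hvol hw f)
    (hasSum_fiberwise comp hcomp (hasSum_pullback_face hface hq hf).summable).summable

/-- Both sides are the sum of n·w·f·g over `V`, grouped along `face` and along `comp`. The sum
converges absolutely, because |fg| ≤ f² + g² and both pullbacks are square-summable. -/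
theorem fiberSum_adjoint (hvol : ∀ a, vol a = ∑ v ∈ (hcomp a).toFinset, n (face v))
    (hpos : ∀ a, 0 < vol a) (hq : ∀ b, (hface b).toFinset.card = q) (hw : ∀ v, w v ^ 2 = 1)
    {f : B → ℝ} (hf : f ∈ weightedL2 n) {g : A → ℝ} (hg : g ∈ weightedL2 vol) :
    ∑' b, (n b : ℝ) * (f b * fiberSum hface comp w g b) =
      ∑' a, (vol a : ℝ) * (fiberMean (face := face) hcomp n vol w f a * g a) := by
  have hs : Summable fun v => (n (face v) : ℝ) * (w v * f (face v)) * g (comp v) := by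
    refine Summable.of_norm_bounded ((hasSum_pullback_face hface hq hf).summable.add
      (hasSum_pullback_comp hcomp hvol hg).summable) fun v => ?_
    have h0 : (0 : ℝ) ≤ n (face v) := Nat.cast_nonneg _
    have h1 : |w v| = 1 :=
      (pow_eq_one_iff_of_nonneg (abs_nonneg _) two_ne_zero).mp ((sq_abs _).trans (hw v))
    rw [Real.norm_eq_abs, abs_mul, abs_mul, abs_mul, h1, abs_of_nonneg h0, one_mul, mul_assoc,
      ← mul_add]
    refine mul_le_mul_of_nonneg_left ?_ h0
    rw [← sq_abs (f (face v)), ← sq_abs (g (comp v))]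
    nlinarith [sq_nonneg (|f (face v)| - |g (comp v)|), sq_nonneg |f (face v)|,
      sq_nonneg |g (comp v)|]
  have h1 := hasSum_fiberwise face hface hs
  have h2 := hasSum_fiberwise comp hcomp hs
  rw [← h1.tsum_eq] at h2
  have e1 : ∀ b, ∑ v ∈ (hface b).toFinset, (n (face v) : ℝ) * (w v * f (face v)) * g (comp v) =
      (n b : ℝ) * (f b * fiberSum hface comp w g b) := by
    intro b
    rw [fiberSum, Finset.mul_sum, Finset.mul_sum]
    refine Finset.sum_congr rfl fun v hv => ?_
    have : face v = b := by simpa using hv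
    rw [this]
    ring
  have e2 : ∀ a, ∑ v ∈ (hcomp a).toFinset, (n (face v) : ℝ) * (w v * f (face v)) * g (comp v) =
      (vol a : ℝ) * (fiberMean (face := face) hcomp n vol w f a * g a) := by
    intro a
    have h0 : (vol a : ℝ) ≠ 0 := Nat.cast_ne_zero.mpr (hpos a).ne'
    rw [fiberMean, ← mul_assoc, mul_div_cancel₀ _ h0, Finset.sum_mul]
    refine Finset.sum_congr rfl fun v hv => ?_
    have : comp v = a := by simpa using hv
    rw [this]
  simp only [e1, e2] at h2
  exact h2.tsum_eq.symm

end

/-! ### Spectral gaps -/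

section

variable {P : Type*} [PartialOrder P] {m : ℕ}

theorem Component.energy_nonneg (a : Component P m) (φ : LinkVertex P m → ℝ) : 0 ≤ a.energy φ := by
  unfold Component.energy
  have : 0 ≤ ∑ᶠ d ∈ a.darts, (φ d.src - φ d.tgt) ^ 2 :=
    finsum_nonneg fun d => finsum_nonneg fun _ => sq_nonneg _
  positivity

theorem Component.energy_affine (a : Component P m) (φ : LinkVertex P m → ℝ) (r μ : ℝ) :
    a.energy (fun v => r * (φ v - μ)) = r ^ 2 * a.energy φ := by
  have h : ∀ d : Dart P m, (r * (φ d.src - μ) - r * (φ d.tgt - μ)) ^ 2 =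
      r ^ 2 * (φ d.src - φ d.tgt) ^ 2 := fun d => by ring
  unfold Component.energy
  simp only [h]
  simp only [← smul_eq_mul (r ^ 2), ← smul_finsum]
  simp only [smul_eq_mul]
  ring

/-- The Poincaré inequality on a component of the link graph. -/
theorem Component.poincare {a : Component P m} (ha : a.supp.Finite) {l : ℝ}
    (hl : (l : EReal) ≤ a.spectralGap) (hvol : 0 < ∑ v ∈ ha.toFinset, (v.degree : ℝ))
    (φ : LinkVertex P m → ℝ) :
    l * (∑ v ∈ ha.toFinset, (v.degree : ℝ) * φ v ^ 2 -
      (∑ v ∈ ha.toFinset, (v.degree : ℝ) * φ v) ^ 2 / ∑ v ∈ ha.toFinset, (v.degree : ℝ)) ≤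
      a.energy φ := by
  set W := ∑ v ∈ ha.toFinset, (v.degree : ℝ) with hW
  set S := ∑ v ∈ ha.toFinset, (v.degree : ℝ) * φ v with hS
  set Q₂ := ∑ v ∈ ha.toFinset, (v.degree : ℝ) * φ v ^ 2 with hQ₂
  have h1 : ∀ r, ∑ v ∈ ha.toFinset, (v.degree : ℝ) * (r * (φ v - S / W)) = 0 := by
    intro r
    have : ∀ v : LinkVertex P m, (v.degree : ℝ) * (r * (φ v - S / W)) =
        r * ((v.degree : ℝ) * φ v) - r * (S / W) * v.degree := fun v => by ring
    simp only [this]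
    rw [Finset.sum_sub_distrib, ← Finset.mul_sum, ← Finset.mul_sum, ← hS, ← hW]
    field_simp
    ring
  have h2 : ∀ r, ∑ v ∈ ha.toFinset, (v.degree : ℝ) * (r * (φ v - S / W)) ^ 2 =
      r ^ 2 * (Q₂ - S ^ 2 / W) := by
    intro r
    have : ∀ v : LinkVertex P m, (v.degree : ℝ) * (r * (φ v - S / W)) ^ 2 =
        r ^ 2 * ((v.degree : ℝ) * φ v ^ 2) - r ^ 2 * (2 * (S / W)) * ((v.degree : ℝ) * φ v) +
          r ^ 2 * (S / W) ^ 2 * v.degree := fun v => by ring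
    simp only [this]
    rw [Finset.sum_add_distrib, Finset.sum_sub_distrib, ← Finset.mul_sum, ← Finset.mul_sum,
      ← Finset.mul_sum, ← hS, ← hW, ← hQ₂]
    field_simp
    ring
  have hQ : 0 ≤ Q₂ - S ^ 2 / W := by
    have h3 := h2 1
    rw [one_pow, one_mul] at h3
    rw [← h3]
    exact Finset.sum_nonneg fun v _ => by positivity
  -- If the variance of `φ` vanishes, only nonnegativity of the energy is needed. Otherwise `φ`
  -- minus its mean, divided by the square root of the variance, is an admissible test function.
  rcases hQ.eq_or_lt with h0 | h0
  · rw [← h0, mul_zero]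
    exact a.energy_nonneg φ
  · have hr : (√(Q₂ - S ^ 2 / W))⁻¹ ^ 2 = (Q₂ - S ^ 2 / W)⁻¹ := by
      rw [inv_pow, Real.sq_sqrt hQ]
    have h4 : a.spectralGap ≤
        (a.energy fun v => (√(Q₂ - S ^ 2 / W))⁻¹ * (φ v - S / W) : ℝ) := by
      unfold Component.spectralGap
      refine iInf_le_of_le _ (iInf_le_of_le ?_ (iInf_le _ ?_))
      · rw [finsum_mem_eq_finite_toFinset_sum _ ha]
        exact h1 _
      · rw [finsum_mem_eq_finite_toFinset_sum _ ha, h2, hr, inv_mul_cancel₀ h0.ne']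
    have h5 := EReal.coe_le_coe_iff.mp (hl.trans h4)
    rw [Component.energy_affine, hr, inv_mul_eq_div, le_div_iff₀ h0] at h5
    exact h5

end

end CubicalGarland

namespace CubicalGarland

section

variable {P : Type*} [PartialOrder P] {m : ℕ}

/-! ### Finiteness -/

theorem finite_cubes_above (hloc : IsLocallyFinite P) {j : ℕ} (x : Face P j) :
    {c : Face P (m + 2) | x.1 ≤ c.1}.Finite :=
  Set.Finite.of_finite_image ((hloc x.1).subset (by rintro _ ⟨c, hc, rfl⟩; exact hc))
    Subtype.val_injective.injOn

theorem topDegree_pos (hloc : IsLocallyFinite P) (hmono : IsMonodromyFree P m)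
    (b : Face P (m + 1)) : 0 < topDegree m b := by
  obtain ⟨c, hc⟩ := exists_cube_above hmono b
  exact (Set.ncard_pos (finite_cubes_above hloc b)).mpr ⟨c, hc.le⟩

theorem finite_face (b : Face P (m + 1)) :
    ((LinkVertex.face : LinkVertex P m → _) ⁻¹' {b}).Finite :=
  Set.finite_coe_iff.mp (finite_verticesOver b)

theorem card_finite_face (hcub : IsCubical P) (b : Face P (m + 1)) :
    (finite_face b).toFinset.card = 2 * (m + 1) + 1 := by
  rw [← card_verticesOver hcub b]
  exact (Set.ncard_eq_toFinset_card _ (finite_face b)).symm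

theorem finite_src (hcub : IsCubical P) (hloc : IsLocallyFinite P) (v : LinkVertex P m) :
    ((Dart.src : Dart P m → _) ⁻¹' {v}).Finite := by
  by_contra h
  -- An infinite set has `ncard` 0, so the degree formula would leave no cube above `v.face`, and
  -- hence no dart at `v`.
  have h1 : v.degree = 0 := Set.Infinite.ncard h
  rw [v.degree_eq hcub, topDegree, Set.ncard_eq_zero (finite_cubes_above hloc _)] at h1
  refine h (Set.Finite.subset Set.finite_empty fun d hd => ?_)
  have hd' : d.src = v := hd
  subst hd'
  exact h1.subset (show d.top ∈ _ from d.fst_lt.le)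

theorem card_finite_src (hcub : IsCubical P) (hloc : IsLocallyFinite P) (v : LinkVertex P m) :
    (finite_src hcub hloc v).toFinset.card = topDegree m v.face := by
  rw [← v.degree_eq hcub]
  exact (Set.ncard_eq_toFinset_card _ (finite_src hcub hloc v)).symm

theorem LinkVertex.ext_face {v v' : LinkVertex P m} (h : v.base = v'.base)
    (h' : v.face = v'.face) : v = v' := by
  obtain ⟨base, b, _⟩ := v
  obtain ⟨base', b', _⟩ := v'
  dsimp only at h h'
  subst h h'
  rfl

/-- Transversal components are finite by hypothesis. In a geometric component the base `p` is fixed,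
so a vertex is determined by its face, one of the finitely many above `p`. -/
theorem finite_component (hloc : IsLocallyFinite P) (htrans : IsTransversallyFinite P m)
    (a : Component P m) : ((LinkVertex.component : LinkVertex P m → _) ⁻¹' {a}).Finite := by
  cases h : a.proj with
  | none => exact htrans a h
  | some p =>
    have hbase : ∀ v ∈ (LinkVertex.component : LinkVertex P m → _) ⁻¹' {a}, v.base = some p := by
      rintro v rfl
      exact h
    refine Set.Finite.of_finite_image (f := fun v : LinkVertex P m => v.face.1)
      ((hloc p.1).subset ?_) ?_
    · rintro _ ⟨v, hv, rfl⟩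
      exact (v.lt p (hbase v hv)).le
    · intro v hv v' hv' hvv'
      exact LinkVertex.ext_face ((hbase v hv).trans (hbase v' hv').symm) (Face.ext hvv')

theorem finite_darts (hcub : IsCubical P) (hloc : IsLocallyFinite P)
    (htrans : IsTransversallyFinite P m) (a : Component P m) :
    ((fun d : Dart P m => d.src.component) ⁻¹' {a}).Finite := by
  refine Set.Finite.subset ((finite_component hloc htrans a).biUnion fun v _ =>
    finite_src hcub hloc v) fun d hd => ?_
  exact Set.mem_biUnion (x := d.src) hd rfl

/-- Counting darts by their source: the weight of a component is the sum of the weights of the faces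
of its vertices, the compatibility required of the two weighted ℓ²-spaces. -/
theorem card_darts (hcub : IsCubical P) (hloc : IsLocallyFinite P)
    (htrans : IsTransversallyFinite P m) (a : Component P m) :
    a.darts.ncard = ∑ v ∈ (finite_component hloc htrans a).toFinset, topDegree m v.face := by
  classical
  have h : a.darts.ncard = (finite_darts hcub hloc htrans a).toFinset.card :=
    Set.ncard_eq_toFinset_card _ _
  rw [h, Finset.card_eq_sum_card_fiberwise (f := Dart.src)
    (t := (finite_component hloc htrans a).toFinset)]
  · refine Finset.sum_congr rfl fun v hv => ?_
    have hv' : v.component = a := by simpa using hv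
    rw [← card_finite_src hcub hloc v]
    congr 1
    ext d
    simp only [Finset.mem_filter, Set.Finite.mem_toFinset, Set.mem_preimage,
      Set.mem_singleton_iff, and_iff_right_iff_imp]
    rintro rfl
    exact hv'
  · intro d hd
    simpa using hd

theorem card_darts_pos (hcub : IsCubical P) (hloc : IsLocallyFinite P)
    (htrans : IsTransversallyFinite P m) (hmono : IsMonodromyFree P m) (a : Component P m) :
    0 < a.darts.ncard := by
  rw [card_darts hcub hloc htrans]
  obtain ⟨v, rfl⟩ := a.exists_rep
  exact Finset.sum_pos (fun v _ => topDegree_pos hloc hmono _) ⟨v, by simp; rfl⟩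

theorem finite_top (c : Face P (m + 2)) : ((Dart.top : Dart P m → _) ⁻¹' {c}).Finite := by
  refine Set.Finite.of_finite_image (f := fun d : Dart P m => (d.fst, d.snd))
    (((Face.finite_below (i := m + 1) c).prod (Face.finite_below (i := m + 1) c)).subset ?_) ?_
  · rintro _ ⟨d, rfl, rfl⟩
    exact ⟨d.fst_lt, d.snd_lt⟩
  · rintro ⟨b, b', c, _, _, _⟩ rfl ⟨b₁, b₁', c₁, _, _, _⟩ h h'
    simp only [Prod.mk.injEq] at h'
    obtain ⟨rfl, rfl⟩ := h'
    have : c₁ = c := h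
    subst this
    rfl

/-! ### Sums over the darts in a cube -/

theorem sum_offDiag_fst {β : Type*} [DecidableEq β] (s : Finset β) (x : β → ℝ) :
    ∑ p ∈ s.offDiag, x p.1 = (s.card - 1) * ∑ b ∈ s, x b := by
  have h := Finset.sum_union (f := fun p : β × β => x p.1) (Finset.disjoint_diag_offDiag s)
  rw [Finset.diag_union_offDiag, Finset.sum_product, Finset.sum_diag] at h
  simp only [Finset.sum_const, nsmul_eq_mul, ← Finset.mul_sum] at h
  linarith

/-- Over all ordered pairs the sum is `s.card` times ∑ x² plus (∑ x)², and the second term vanishes;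
the diagonal accounts for 2 ∑ x². -/
theorem sum_offDiag_sq {β : Type*} [DecidableEq β] (s : Finset β) (x : β → ℝ)
    (hx : ∑ b ∈ s, x b = 0) :
    ∑ p ∈ s.offDiag, (x p.1 + x p.2) ^ 2 / 2 = (s.card - 2) * ∑ b ∈ s, x b ^ 2 := by
  have h := Finset.sum_union (f := fun p : β × β => (x p.1 + x p.2) ^ 2 / 2)
    (Finset.disjoint_diag_offDiag s)
  rw [Finset.diag_union_offDiag, Finset.sum_product, Finset.sum_diag] at h
  have h1 : ∀ b ∈ s, ∑ b' ∈ s, (x b + x b') ^ 2 / 2 =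
      s.card * x b ^ 2 / 2 + (∑ b' ∈ s, x b' ^ 2) / 2 := by
    intro b _
    have h2 : ∀ b', (x b + x b') ^ 2 / 2 = x b ^ 2 / 2 + x b * x b' + x b' ^ 2 / 2 := fun b' => by
      ring
    simp only [h2, Finset.sum_add_distrib, Finset.sum_const, nsmul_eq_mul, ← Finset.mul_sum, hx,
      ← Finset.sum_div]
    ring
  have h3 : ∀ b, (x b + x b) ^ 2 / 2 = 2 * x b ^ 2 := fun b => by ring
  rw [Finset.sum_congr rfl h1] at h
  simp only [h3, Finset.sum_add_distrib, Finset.sum_const, nsmul_eq_mul, ← Finset.mul_sum,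
    ← Finset.sum_div] at h
  rw [← Finset.sum_div]
  linarith

theorem sum_top_eq_sum_offDiag [DecidableEq (Face P (m + 1))] (c : Face P (m + 2))
    (H : Face P (m + 1) × Face P (m + 1) → ℝ) :
    ∑ d ∈ (finite_top c).toFinset, H (d.fst, d.snd) =
      ∑ p ∈ (Face.finite_below (i := m + 1) c).toFinset.offDiag, H p := by
  refine Finset.sum_bij (fun d _ => (d.fst, d.snd)) ?_ ?_ ?_ fun _ _ => rfl
  · intro d hd
    have hd' : d.top = c := by simpa using hd
    subst hd'
    simpa using ⟨d.fst_lt, d.snd_lt, d.ne⟩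
  · rintro ⟨b, b', c₁, _, _, _⟩ h₁ ⟨b₂, b₂', c₂, _, _, _⟩ h₂ h
    have e₁ : c₁ = c := by simpa using h₁
    have e₂ : c₂ = c := by simpa using h₂
    simp only [Prod.mk.injEq] at h
    obtain ⟨rfl, rfl⟩ := h
    obtain rfl := e₁.trans e₂.symm
    rfl
  · rintro ⟨b, b'⟩ h
    have h : b.1 < c.1 ∧ b'.1 < c.1 ∧ b ≠ b' := by simpa using h
    exact ⟨⟨b, b', c, h.1, h.2.1, h.2.2⟩, by simp, rfl⟩

/-! ### The energy of a cocycle inside one cube -/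

variable {χ : Charts P} {w : LinkVertex P m → ℤ}

theorem IsGarlandOrientation.sq (hw : IsGarlandOrientation χ w) (v : LinkVertex P m) :
    (w v : ℝ) ^ 2 = 1 := by
  rcases hw.sign v with h | h <;> simp [h]

theorem incidence_sq {j : ℕ} {b : Face P j} {c : Face P (j + 1)} (h : b.1 < c.1) :
    (incidence χ b c : ℝ) ^ 2 = 1 := by
  rcases incidence_sign χ h with h | h <;> simp [h]

/-- The sign rule says that the product of the two Garland signs is minus the product of the two
incidence numbers. It turns differences along an edge into the sums that occur in the cocycle
equation. -/
theorem IsGarlandOrientation.sq_sub (hw : IsGarlandOrientation χ w) (f : Face P (m + 1) → ℝ)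
    (d : Dart P m) : ((w d.src : ℝ) * f d.src.face - (w d.tgt : ℝ) * f d.tgt.face) ^ 2 =
      ((incidence χ d.fst d.top : ℝ) * f d.fst + (incidence χ d.snd d.top : ℝ) * f d.snd) ^ 2 := by
  have h1 : (w d.src : ℝ) * incidence χ d.fst d.top = -(w d.tgt * incidence χ d.snd d.top) := by
    exact_mod_cast hw.cancel d
  have h2 := hw.sq d.src
  have h3 := hw.sq d.tgt
  have h4 := incidence_sq (χ := χ) d.fst_lt
  have h5 := incidence_sq (χ := χ) d.snd_lt
  change ((w d.src : ℝ) * f d.fst - (w d.tgt : ℝ) * f d.snd) ^ 2 = _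
  have h6 : (w d.src : ℝ) * w d.tgt =
      -((incidence χ d.fst d.top : ℝ) * incidence χ d.snd d.top) := by
    have h7 : (w d.src : ℝ) = -(w d.tgt * incidence χ d.snd d.top) * incidence χ d.fst d.top := by
      rw [← h1]
      linear_combination -(w d.src : ℝ) * h4
    rw [h7]
    linear_combination
      -(incidence χ d.snd d.top : ℝ) * (incidence χ d.fst d.top : ℝ) * h3
  linear_combination f d.fst ^ 2 * (h2 - h4) + f d.snd ^ 2 * (h3 - h5) - 2 * f d.fst * f d.snd * h6

/-- The local form of the energy identity for cocycles. -/
theorem sum_top_energy (hcub : IsCubical P) (hw : IsGarlandOrientation χ w)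
    {f : Face P (m + 1) → ℝ} (hf : coboundary χ (m + 1) f = 0) (c : Face P (m + 2)) :
    (2 * (m + 1) + 1 : ℝ) * ∑ d ∈ (finite_top c).toFinset,
      ((w d.src : ℝ) * f d.src.face - (w d.tgt : ℝ) * f d.tgt.face) ^ 2 / 2 =
      2 * (m + 1) * ∑ d ∈ (finite_top (m := m) c).toFinset, f d.fst ^ 2 := by
  classical
  set s := (Face.finite_below (i := m + 1) c).toFinset with hs
  have hcard : (s.card : ℝ) = 2 * (m + 2) := by
    have := card_facets hcub (j := m + 1) c
    rw [hs, this]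
    push_cast
    ring
  have h1 : ∑ d ∈ (finite_top c).toFinset,
      ((w d.src : ℝ) * f d.src.face - (w d.tgt : ℝ) * f d.tgt.face) ^ 2 / 2 =
      (s.card - 2) * ∑ b ∈ s, ((incidence χ b c : ℝ) * f b) ^ 2 := by
    rw [← sum_offDiag_sq s (fun b => (incidence χ b c : ℝ) * f b) (congrFun hf c),
      ← sum_top_eq_sum_offDiag c
        fun p => ((incidence χ p.1 c : ℝ) * f p.1 + (incidence χ p.2 c : ℝ) * f p.2) ^ 2 / 2]
    refine Finset.sum_congr rfl fun d hd => ?_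
    have hd' : d.top = c := by simpa using hd
    subst hd'
    rw [hw.sq_sub]
  have h2 : ∑ d ∈ (finite_top (m := m) c).toFinset, f d.fst ^ 2 =
      (s.card - 1) * ∑ b ∈ s, f b ^ 2 := by
    rw [← sum_offDiag_fst s fun b => f b ^ 2, ← sum_top_eq_sum_offDiag c fun p => f p.1 ^ 2]
  have h3 : ∑ b ∈ s, ((incidence χ b c : ℝ) * f b) ^ 2 = ∑ b ∈ s, f b ^ 2 := by
    refine Finset.sum_congr rfl fun b hb => ?_
    have hb' : b.1 < c.1 := by simpa [hs] using hb
    rw [mul_pow, incidence_sq hb', one_mul]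
  -- A (k+1)-cube has 2(k+1) facets, so the factors `s.card - 2` and `s.card - 1` are 2k and 2k + 1.
  rw [h1, h2, h3, hcard]
  ring

/-! ### Garland coboundaries are cocycles -/

/-- The reversed dart. -/
def Dart.rev (d : Dart P m) : Dart P m := ⟨d.snd, d.fst, d.top, d.snd_lt, d.fst_lt, d.ne.symm⟩

theorem Dart.src_rev (d : Dart P m) : d.rev.src = d.tgt :=
  LinkVertex.ext_face (bowtie_comm _ _) rfl

theorem garlandCoboundary_eq (w : LinkVertex P m → ℤ) (g : Component P m → ℝ) :
    garlandCoboundary w g =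
      fiberSum finite_face LinkVertex.component (fun v => (w v : ℝ)) g := by
  funext b
  exact finsum_mem_eq_finite_toFinset_sum _ (finite_face b)

/-- A vertex over a facet of `c` begins exactly one dart in `c`, so the coboundary at `c` is a sum
over the darts of `c`, on which reversal acts freely. -/
theorem coboundary_garlandCoboundary (hcub : IsCubical P) (hw : IsGarlandOrientation χ w)
    (g : Component P m → ℝ) : coboundary χ (m + 1) (garlandCoboundary w g) = 0 := by
  classical
  funext c
  change ∑ b ∈ (Face.finite_below (i := m + 1) c).toFinset,
    (incidence χ b c : ℝ) * garlandCoboundary w g b = 0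
  have h1 : ∑ b ∈ (Face.finite_below (i := m + 1) c).toFinset,
      (incidence χ b c : ℝ) * garlandCoboundary w g b =
      ∑ d ∈ (finite_top (m := m) c).toFinset,
        (incidence χ d.fst c : ℝ) * (w d.src * g d.src.component) := by
    rw [garlandCoboundary_eq]
    simp only [fiberSum, Finset.mul_sum]
    rw [Finset.sum_sigma']
    symm
    refine Finset.sum_bij (fun d _ => ⟨d.fst, d.src⟩) ?_ ?_ ?_ fun _ _ => rfl
    · intro d hd
      have hd' : d.top = c := by simpa using hd
      subst hd'
      simpa using ⟨d.fst_lt, rfl⟩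
    · intro d hd d' hd' h
      have hd : d.top = c := by simpa using hd
      have hd' : d'.top = c := by simpa using hd'
      simp only [Sigma.mk.injEq] at h
      have hsrc : d.src = d'.src := eq_of_heq h.2
      obtain ⟨d₀, -, huniq⟩ := existsUnique_dart hcub d.src c (hd ▸ d.fst_lt)
      rw [huniq d rfl hd, huniq d' hsrc.symm hd']
    · rintro ⟨b, v⟩ hv
      have hv : b.1 < c.1 ∧ v.face = b := by simpa using hv
      obtain ⟨hb, rfl⟩ := hv
      obtain ⟨d, ⟨rfl, rfl⟩, -⟩ := existsUnique_dart hcub v c hb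
      exact ⟨d, by simp, rfl⟩
  rw [h1]
  -- A dart and its reverse belong to the same component, hence carry the same value of `g`, and
  -- their signs cancel by the Garland condition.
  refine Finset.sum_involution (fun d _ => d.rev) ?_ ?_ ?_ ?_
  · intro d hd
    have hd' : d.top = c := by simpa using hd
    subst hd'
    have h2 : (w d.src : ℝ) * incidence χ d.fst d.top =
        -(w d.tgt * incidence χ d.snd d.top) := by
      exact_mod_cast hw.cancel d
    rw [d.src_rev, d.tgt_component]
    change _ + (incidence χ d.snd d.top : ℝ) * _ = 0
    linear_combination g d.src.component * h2
  · intro d _ _ h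
    exact d.ne (congrArg Dart.snd h)
  · intro d hd
    simpa [Dart.rev] using hd
  · intro d _
    rfl

end

end CubicalGarland

namespace CubicalGarland

section

variable {P : Type*} [PartialOrder P] {m : ℕ} {χ : Charts P} {w : LinkVertex P m → ℤ}

/-! ### Garland's inequality -/

/-- The norm of a cochain, distributed over the components of the link graph. -/
theorem hasSum_localNorm (hcub : IsCubical P) (hloc : IsLocallyFinite P)
    (htrans : IsTransversallyFinite P m) {f : Face P (m + 1) → ℝ}
    (hf : f ∈ l2Cochains P m (m + 1)) :
    HasSum (fun a : Component P m => ∑ v ∈ (finite_component hloc htrans a).toFinset,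
      (topDegree m v.face : ℝ) * f v.face ^ 2)
      ((2 * (m + 1) + 1) * ∑' b, (topDegree m b : ℝ) * f b ^ 2) := by
  have h := hasSum_pullback_face finite_face (card_finite_face hcub) hf
  have hsum := hasSum_fiberwise LinkVertex.component (finite_component hloc htrans) h.summable
  rw [h.tsum_eq] at hsum
  push_cast at hsum
  exact hsum

/-- The energy of a cocycle, distributed over the components of the link graph. -/
theorem hasSum_energy (hcub : IsCubical P) (hloc : IsLocallyFinite P)
    (htrans : IsTransversallyFinite P m) (hw : IsGarlandOrientation χ w)
    {f : Face P (m + 1) → ℝ} (hf : f ∈ cocycles χ m) :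
    HasSum (fun a : Component P m => a.energy fun v => (w v : ℝ) * f v.face)
      (2 * (m + 1) * ∑' b, (topDegree m b : ℝ) * f b ^ 2) := by
  have hq : (0 : ℝ) < 2 * (m + 1) + 1 := by positivity
  have h := hasSum_pullback_face finite_face (card_finite_face hcub) hf.1
  have hsrc : ∀ v : LinkVertex P m, ∑ d ∈ (finite_src hcub hloc v).toFinset, f d.fst ^ 2 =
      (topDegree m v.face : ℝ) * f v.face ^ 2 := by
    intro v
    rw [← card_finite_src hcub hloc v, ← nsmul_eq_mul, ← Finset.sum_const]
    refine Finset.sum_congr rfl fun d hd => ?_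
    have hd' : d.src = v := by simpa using hd
    subst hd'
    rfl
  have hs₁ : Summable fun d : Dart P m => f d.fst ^ 2 := by
    rw [summable_iff_fiberwise Dart.src (finite_src hcub hloc) fun d => sq_nonneg _]
    simp only [hsrc]
    exact h.summable
  have ht₁ : ∑' d : Dart P m, f d.fst ^ 2 =
      (2 * (m + 1) + 1) * ∑' b, (topDegree m b : ℝ) * f b ^ 2 := by
    have h1 := hasSum_fiberwise Dart.src (finite_src hcub hloc) hs₁
    simp only [hsrc] at h1
    rw [h1.unique h]
    push_cast
    ring
  have htop : ∀ c : Face P (m + 2), ∑ d ∈ (finite_top c).toFinset,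
      ((w d.src : ℝ) * f d.src.face - (w d.tgt : ℝ) * f d.tgt.face) ^ 2 / 2 =
      2 * (m + 1) / (2 * (m + 1) + 1) * ∑ d ∈ (finite_top (m := m) c).toFinset, f d.fst ^ 2 := by
    intro c
    have h1 := sum_top_energy hcub hw (LinearMap.mem_ker.mp hf.2) c
    rw [div_mul_eq_mul_div, eq_div_iff hq.ne', ← h1]
    ring
  have hfib := (hasSum_fiberwise Dart.top finite_top hs₁).mul_left
    (2 * (m + 1) / (2 * (m + 1) + 1) : ℝ)
  have hs₂ : Summable fun d : Dart P m =>
      ((w d.src : ℝ) * f d.src.face - (w d.tgt : ℝ) * f d.tgt.face) ^ 2 / 2 := by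
    rw [summable_iff_fiberwise Dart.top finite_top fun d => by positivity]
    simp only [htop]
    exact hfib.summable
  have h2 := hasSum_fiberwise Dart.top finite_top hs₂
  simp only [htop] at h2
  -- The same sum over darts, already evaluated cube by cube, is regrouped by components.
  have h3 := hasSum_fiberwise (fun d : Dart P m => d.src.component)
    (finite_darts hcub hloc htrans) hs₂
  rw [h2.unique hfib, ht₁] at h3
  have h4 : 2 * (m + 1) / (2 * (m + 1) + 1) *
      ((2 * (m + 1) + 1) * ∑' b, (topDegree m b : ℝ) * f b ^ 2) =
        2 * (m + 1) * ∑' b, (topDegree m b : ℝ) * f b ^ 2 := by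
    field_simp
  rw [h4] at h3
  convert h3 using 2 with a
  rw [← Finset.sum_div, Component.energy]
  congr 1
  exact finsum_mem_eq_finite_toFinset_sum _ (finite_darts hcub hloc htrans a)

/-- The mean values of a cochain on the components of the link graph. -/
noncomputable abbrev componentMean (hloc : IsLocallyFinite P) (htrans : IsTransversallyFinite P m)
    (w : LinkVertex P m → ℤ) (f : Face P (m + 1) → ℝ) (a : Component P m) : ℝ :=
  fiberMean (face := LinkVertex.face) (finite_component hloc htrans) (topDegree m)
    (fun a => a.darts.ncard) (fun v => (w v : ℝ)) f a

/-- The Poincaré inequality for v ↦ w(v) f(b). The signs square to one in the norm, and the square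
of the weighted sum divided by the volume is the volume times the squared mean. -/
theorem gap_mul_le_energy (hcub : IsCubical P) (hloc : IsLocallyFinite P)
    (htrans : IsTransversallyFinite P m) (hmono : IsMonodromyFree P m)
    (hw : IsGarlandOrientation χ w) {a : Component P m} {l : ℝ} (hl : (l : EReal) ≤ a.spectralGap)
    (f : Face P (m + 1) → ℝ) :
    l * (∑ v ∈ (finite_component hloc htrans a).toFinset,
        (topDegree m v.face : ℝ) * f v.face ^ 2 -
      (a.darts.ncard : ℝ) * componentMean hloc htrans w f a ^ 2) ≤
      a.energy fun v => (w v : ℝ) * f v.face := by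
  have hpos : (0 : ℝ) < a.darts.ncard :=
    Nat.cast_pos.mpr (card_darts_pos hcub hloc htrans hmono a)
  have hvol : ∑ v ∈ (finite_component hloc htrans a).toFinset, (v.degree : ℝ) =
      a.darts.ncard := by
    rw [card_darts hcub hloc htrans, Nat.cast_sum]
    exact Finset.sum_congr rfl fun v _ => by rw [v.degree_eq hcub]
  have h : l * (∑ v ∈ (finite_component hloc htrans a).toFinset,
      (v.degree : ℝ) * ((w v : ℝ) * f v.face) ^ 2 -
        (∑ v ∈ (finite_component hloc htrans a).toFinset,
          (v.degree : ℝ) * ((w v : ℝ) * f v.face)) ^ 2 /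
            ∑ v ∈ (finite_component hloc htrans a).toFinset, (v.degree : ℝ)) ≤
      a.energy fun v => (w v : ℝ) * f v.face :=
    Component.poincare (finite_component hloc htrans a) hl (lt_of_lt_of_eq hpos hvol.symm) _
  refine le_trans (le_of_eq ?_) h
  rw [hvol, componentMean, fiberMean]
  simp only [LinkVertex.degree_eq hcub, mul_pow, hw.sq, one_mul]
  congr 2
  field_simp

/-- Summing the local inequalities over all components compares `l` times (2k+1)‖f‖² − ‖Mf‖² with
the total energy 2k‖f‖². -/
theorem componentMean_bounded_below (hcub : IsCubical P) (hloc : IsLocallyFinite P)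
    (htrans : IsTransversallyFinite P m) (hmono : IsMonodromyFree P m)
    (hw : IsGarlandOrientation χ w) {l : ℝ} (hl₀ : (2 * (m + 1) : ℝ) / (2 * (m + 1) + 1) < l)
    (hl : ∀ a : Component P m, (l : EReal) ≤ a.spectralGap) :
    ∃ ε : ℝ, 0 < ε ∧ ∀ f ∈ cocycles χ m, ε * ∑' b, (topDegree m b : ℝ) * f b ^ 2 ≤
      ∑' a : Component P m, (a.darts.ncard : ℝ) * componentMean hloc htrans w f a ^ 2 := by
  have hq : (0 : ℝ) < 2 * (m + 1) + 1 := by positivity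
  have hlpos : 0 < l := lt_trans (by positivity) hl₀
  rw [div_lt_iff₀ hq] at hl₀
  -- This is 2k + 1 − 2k/l, positive precisely because l > 2k/(2k+1).
  refine ⟨(2 * (m + 1) + 1) - 2 * (m + 1) / l, ?_, fun f hf => ?_⟩
  · rw [sub_pos, div_lt_iff₀ hlpos]
    linarith
  · have hM := fiberMean_mem finite_face (finite_component hloc htrans)
      (card_darts hcub hloc htrans) (card_finite_face hcub) hw.sq hf.1
    have h := ((hasSum_localNorm hcub hloc htrans hf.1).sub hM.hasSum).mul_left l
    have h' := hasSum_le (fun a => gap_mul_le_energy hcub hloc htrans hmono hw (hl a) f) h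
      (hasSum_energy hcub hloc htrans hw hf)
    rw [← mul_le_mul_iff_of_pos_left hlpos]
    have h1 : l * ((2 * (m + 1) + 1 - 2 * (m + 1) / l) * ∑' b, (topDegree m b : ℝ) * f b ^ 2) =
        l * ((2 * (m + 1) + 1) * ∑' b, (topDegree m b : ℝ) * f b ^ 2) -
          2 * (m + 1) * ∑' b, (topDegree m b : ℝ) * f b ^ 2 := by
      field_simp
    rw [h1]
    linarith

/-- When all means vanish, each energy is at least 2k/(2k+1) times the local norm, while the totals
of both sides agree. Equality therefore holds on every component, and the strict gap forces each
local norm to vanish. No uniformity of the gaps is needed. -/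
theorem eq_zero_of_componentMean_eq_zero (hcub : IsCubical P) (hloc : IsLocallyFinite P)
    (htrans : IsTransversallyFinite P m) (hmono : IsMonodromyFree P m)
    (hw : IsGarlandOrientation χ w)
    (hgap : ∀ a : Component P m,
      (((2 * (m + 1) : ℝ) / (2 * (m + 1) + 1) : ℝ) : EReal) < a.spectralGap)
    {f : Face P (m + 1) → ℝ} (hf : f ∈ cocycles χ m) (hM : componentMean hloc htrans w f = 0) :
    f = 0 := by
  have hq : (0 : ℝ) < 2 * (m + 1) + 1 := by positivity
  set S : Component P m → ℝ := fun a => ∑ v ∈ (finite_component hloc htrans a).toFinset,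
    (topDegree m v.face : ℝ) * f v.face ^ 2 with hS
  have hS0 : ∀ a, 0 ≤ S a := fun a => Finset.sum_nonneg fun v _ => by positivity
  have hle : ∀ a (l : ℝ), (l : EReal) ≤ a.spectralGap →
      l * S a ≤ a.energy fun v => (w v : ℝ) * f v.face := by
    intro a l hl
    have h := gap_mul_le_energy hcub hloc htrans hmono hw hl f
    rw [hM] at h
    simpa using h
  have hsum := (hasSum_energy hcub hloc htrans hw hf).sub
    ((hasSum_localNorm hcub hloc htrans hf.1).mul_left (2 * (m + 1) / (2 * (m + 1) + 1) : ℝ))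
  have h0 : 2 * (m + 1) * ∑' b, (topDegree m b : ℝ) * f b ^ 2 - 2 * (m + 1) / (2 * (m + 1) + 1) *
      ((2 * (m + 1) + 1) * ∑' b, (topDegree m b : ℝ) * f b ^ 2) = 0 := by
    field_simp
    ring
  rw [h0, hasSum_zero_iff_of_nonneg fun a => sub_nonneg.mpr (hle a _ (hgap a).le)] at hsum
  have hSzero : ∀ a, S a = 0 := by
    intro a
    obtain ⟨l, hl₁, hl₂⟩ := EReal.lt_iff_exists_real_btwn.mp (hgap a)
    have hl₁ := EReal.coe_lt_coe_iff.mp hl₁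
    have h1 := hle a l hl₂.le
    have h2 : (a.energy fun v => (w v : ℝ) * f v.face) -
      2 * (m + 1) / (2 * (m + 1) + 1) * S a = 0 := congrFun hsum a
    by_contra hne
    have h3 : 0 < S a := lt_of_le_of_ne (hS0 a) (Ne.symm hne)
    have h4 := mul_lt_mul_of_pos_right hl₁ h3
    linarith
  -- Every face `b` occurs in some component, for instance that of (φ, `b`), and its weight is
  -- positive.
  funext b
  have h5 := (Finset.sum_eq_zero_iff_of_nonneg fun v _ => by positivity).mp
    (hSzero (LinkVertex.transversal b).component) (LinkVertex.transversal b) (by simp)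
  have h6 : (topDegree m b : ℝ) * f b ^ 2 = 0 := h5
  have h7 : (topDegree m b : ℝ) ≠ 0 := Nat.cast_ne_zero.mpr (topDegree_pos hloc hmono b).ne'
  simpa [h7] using h6

/-! ### The image of the connecting homomorphism -/

/-- The Garland coboundary as a linear map. -/
noncomputable def garlandMap (w : LinkVertex P m → ℤ) :
    (Component P m → ℝ) →ₗ[ℝ] (Face P (m + 1) → ℝ) where
  toFun := garlandCoboundary w
  map_add' g g' := by
    simp only [garlandCoboundary_eq]
    funext b
    simp [fiberSum, mul_add, Finset.sum_add_distrib]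
  map_smul' r g := by
    simp only [garlandCoboundary_eq]
    funext b
    simp [fiberSum, Finset.mul_sum, mul_left_comm]

/-- Each value of the coboundary is a finite sum, so the cocycle condition is closed even for
pointwise convergence. -/
theorem isClosed_ker_coboundary (χ : Charts P) (j : ℕ) :
    IsClosed (LinearMap.ker (coboundary χ j) : Set (Face P j → ℝ)) := by
  have hc : Continuous (coboundary χ j) := by
    refine continuous_pi fun c => ?_
    exact continuous_finsetSum _ fun b _ => continuous_const.mul (continuous_apply b)
  exact isClosed_singleton.preimage hc

theorem garlandCoboundary_mem_cocycles (hcub : IsCubical P) (hloc : IsLocallyFinite P)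
    (htrans : IsTransversallyFinite P m) (hw : IsGarlandOrientation χ w) {g : Component P m → ℝ}
    (hg : g ∈ l2Components P m) : garlandCoboundary w g ∈ cocycles χ m := by
  refine ⟨?_, LinearMap.mem_ker.mpr (coboundary_garlandCoboundary hcub hw g)⟩
  rw [garlandCoboundary_eq]
  exact (fiberSum_mem finite_face (finite_component hloc htrans) (card_darts hcub hloc htrans)
    (card_finite_face hcub) hw.sq hg).1

theorem garlandCoboundary_range (hcub : IsCubical P) (hloc : IsLocallyFinite P)
    (htrans : IsTransversallyFinite P m) (hmono : IsMonodromyFree P m)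
    (hw : IsGarlandOrientation χ w) :
    ((∃ ε : ℝ, 0 < ε ∧ ∀ f ∈ cocycles χ m, ε * ∑' b, (topDegree m b : ℝ) * f b ^ 2 ≤
        ∑' a : Component P m, (a.darts.ncard : ℝ) * componentMean hloc htrans w f a ^ 2) →
      ∀ f ∈ cocycles χ m, ∃ g ∈ l2Components P m, garlandCoboundary w g = f) ∧
    ((∀ f ∈ cocycles χ m, componentMean hloc htrans w f = 0 → f = 0) →
      ∀ f ∈ cocycles χ m, ∀ ε : ℝ, 0 < ε → ∃ g ∈ l2Components P m,
        ∑' b, (topDegree m b : ℝ) * (f b - garlandCoboundary w g b) ^ 2 < ε) := by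
  have hvol := card_darts hcub hloc htrans
  refine weighted_range (card_darts_pos hcub hloc htrans hmono) (topDegree_pos hloc hmono)
    (garlandMap w) (componentMean hloc htrans w) (LinearMap.ker (coboundary χ (m + 1)))
    (isClosed_ker_coboundary χ _)
    (fun g hg => (garlandCoboundary_mem_cocycles hcub hloc htrans hw hg).1)
    (fun g hg => (garlandCoboundary_mem_cocycles hcub hloc htrans hw hg).2)
    -- The constant is the number 2k + 1 of vertices over a face, from Cauchy–Schwarz.
    (C := (2 * (m + 1) + 1 : ℕ)) (fun g hg => ?_)
    (fun f hf => fiberMean_mem finite_face _ hvol (card_finite_face hcub) hw.sq hf)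
    (fun f hf g hg => ?_)
  · change ∑' b, (topDegree m b : ℝ) * garlandCoboundary w g b ^ 2 ≤ _
    rw [garlandCoboundary_eq]
    exact (fiberSum_mem finite_face _ hvol (card_finite_face hcub) hw.sq hg).2
  · change ∑' b, (topDegree m b : ℝ) * (f b * garlandCoboundary w g b) = _
    rw [garlandCoboundary_eq]
    exact fiberSum_adjoint finite_face _ hvol (card_darts_pos hcub hloc htrans hmono)
      (card_finite_face hcub) hw.sq hf hg

theorem mem_l2Components_of_sq_le {g g' : Component P m → ℝ} (hg : g ∈ l2Components P m)
    (h : ∀ a, g' a ^ 2 ≤ g a ^ 2) : g' ∈ l2Components P m :=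
  Summable.of_nonneg_of_le (fun _ => by positivity)
    (fun a => mul_le_mul_of_nonneg_left (h a) (Nat.cast_nonneg _)) hg

/-- Every component is transversal or geometric. Cutting `g` off to either kind keeps it
square-summable, and both pieces again give cocycles. -/
theorem class_garlandCoboundary_mem (hcub : IsCubical P) (hloc : IsLocallyFinite P)
    (htrans : IsTransversallyFinite P m) (hw : IsGarlandOrientation χ w) {g : Component P m → ℝ}
    (hg : g ∈ l2Components P m) (z : cocycles χ m) (hz : z.1 = garlandCoboundary w g) :
    cohomologyClass χ m z ∈ geometricClasses χ w ⊔ transversalClasses χ w := by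
  classical
  let g₁ : Component P m → ℝ := fun a => if a.IsTransversal then 0 else g a
  let g₂ : Component P m → ℝ := fun a => if a.IsTransversal then g a else 0
  have hg₁ : g₁ ∈ l2Components P m := mem_l2Components_of_sq_le hg fun a => by
    simp only [g₁]
    split_ifs <;> simp [sq_nonneg]
  have hg₂ : g₂ ∈ l2Components P m := mem_l2Components_of_sq_le hg fun a => by
    simp only [g₂]
    split_ifs <;> simp [sq_nonneg]
  have hadd : g₁ + g₂ = g := by
    funext a
    simp only [g₁, g₂, Pi.add_apply]
    split_ifs <;> simp
  let z₁ : cocycles χ m := ⟨_, garlandCoboundary_mem_cocycles hcub hloc htrans hw hg₁⟩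
  let z₂ : cocycles χ m := ⟨_, garlandCoboundary_mem_cocycles hcub hloc htrans hw hg₂⟩
  have hz' : z = z₁ + z₂ := by
    apply Subtype.ext
    rw [hz, ← hadd]
    exact map_add (garlandMap w) g₁ g₂
  rw [hz', map_add]
  refine Submodule.add_mem_sup (Submodule.subset_span ⟨g₁, hg₁, fun a ha => ?_, z₁, rfl, rfl⟩)
    (Submodule.subset_span ⟨g₂, hg₂, fun a ha => if_neg ha, z₂, rfl, rfl⟩)
  refine if_pos ?_
  cases h : a.proj with
  | none => exact h
  | some p => exact absurd ⟨p, h⟩ ha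

theorem finite_components [Finite P] : Finite (Component P m) := by
  have : ∀ j, Finite (Face P j) := fun j => Subtype.finite
  have : Finite (LinkVertex P m) :=
    Finite.of_injective (fun v : LinkVertex P m => (v.base, v.face)) fun v v' h =>
      LinkVertex.ext_face (congrArg Prod.fst h) (congrArg Prod.snd h)
  exact Quot.finite _

theorem lt_iInf_of_finite {ι : Type*} [Finite ι] {f : ι → EReal} {x : ℝ}
    (h : ∀ i, (x : EReal) < f i) : (x : EReal) < ⨅ i, f i := by
  rcases isEmpty_or_nonempty ι with hι | hι
  -- Without any components the infimum is `⊤`.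
  · rw [iInf_of_empty]
    exact EReal.coe_lt_top x
  · obtain ⟨i, hi⟩ := exists_eq_ciInf_of_finite (f := f)
    rw [← hi]
    exact h i

end

end CubicalGarland

/-! ### The theorem -/

theorem mainTheorem4 {P : Type*} [PartialOrder P] (k m : ℕ) (hk : k = m + 1)
    (hcub : CubicalGarland.IsCubical P) (hloc : CubicalGarland.IsLocallyFinite P)
    (htrans : CubicalGarland.IsTransversallyFinite P m)
    (hmono : CubicalGarland.IsMonodromyFree P m)
    (hgap : ∀ a : CubicalGarland.Component P m,
      (((2 * k : ℝ) / (2 * k + 1) : ℝ) : EReal) < a.spectralGap)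
    (χ : CubicalGarland.Charts P) :
    (∃ w : CubicalGarland.LinkVertex P m → ℤ, CubicalGarland.IsGarlandOrientation χ w) ∧
    ∀ w : CubicalGarland.LinkVertex P m → ℤ, CubicalGarland.IsGarlandOrientation χ w →
      (Finite P →
        CubicalGarland.geometricClasses χ w ⊔ CubicalGarland.transversalClasses χ w = ⊤) ∧
      ((((2 * k : ℝ) / (2 * k + 1) : ℝ) : EReal) <
          (⨅ a : CubicalGarland.Component P m, a.spectralGap) →
        CubicalGarland.geometricClasses χ w ⊔ CubicalGarland.transversalClasses χ w = ⊤) ∧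
      CubicalGarland.IsDense χ
        (CubicalGarland.geometricClasses χ w ⊔ CubicalGarland.transversalClasses χ w) := by
  subst hk
  push_cast at hgap ⊢
  refine ⟨CubicalGarland.exists_garlandOrientation hcub hmono χ, fun w hw => ?_⟩
  have hrange := CubicalGarland.garlandCoboundary_range hcub hloc htrans hmono hw
  have huniform : (((2 * (m + 1) : ℝ) / (2 * (m + 1) + 1) : ℝ) : EReal) <
      (⨅ a : CubicalGarland.Component P m, a.spectralGap) →
      CubicalGarland.geometricClasses χ w ⊔ CubicalGarland.transversalClasses χ w = ⊤ := by
    intro hinf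
    obtain ⟨l, hl₁, hl₂⟩ := EReal.lt_iff_exists_real_btwn.mp hinf
    have hsurj := hrange.1 (CubicalGarland.componentMean_bounded_below hcub hloc htrans hmono hw
      (EReal.coe_lt_coe_iff.mp hl₁) fun a => hl₂.le.trans (iInf_le _ a))
    rw [eq_top_iff]
    rintro ξ -
    obtain ⟨z, rfl⟩ := Submodule.mkQ_surjective _ ξ
    obtain ⟨g, hg, hgz⟩ := hsurj z.1 z.2
    exact CubicalGarland.class_garlandCoboundary_mem hcub hloc htrans hw hg z hgz.symm
  -- A finite poset has finitely many components, so the infimum of the gaps is attained and the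
  -- uniform case applies.
  refine ⟨fun hfin => huniform ?_, huniform, fun f ε hε => ?_⟩
  · have := CubicalGarland.finite_components (P := P) (m := m)
    exact CubicalGarland.lt_iInf_of_finite hgap
  -- The approximating cocycle is itself a Garland coboundary, so its class lies in L + T.
  · obtain ⟨g, hg, hgε⟩ := hrange.2 (fun f hf hM =>
      CubicalGarland.eq_zero_of_componentMean_eq_zero hcub hloc htrans hmono hw hgap hf hM)
      f.1 f.2 ε hε
    exact ⟨⟨_, CubicalGarland.garlandCoboundary_mem_cocycles hcub hloc htrans hw hg⟩,
      CubicalGarland.class_garlandCoboundary_mem hcub hloc htrans hw hg _ rfl, hgε⟩
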